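/- For integers $n_1,\dots,n_k\ge 0$ let $T_{n_1,\dots,n_k}$ be the starlike tree with a centre $u$ such that $T-u$ is the disjoint union of $n_i$ copies of the path $P_i$ on $i$ vertices ($1\le i\le k$), each joined to $u$ by one of its end vertices. For a graph $G$ let $f_G(x)=\det(xI-A(G))$ be its characteristic polynomial and $\lambda_1(G)$ its largest eigenvalue; $G$ is called quadratic if all its eigenvalues are algebraic integers of degree at most two. For $a,b\in\mathbb Z$ we say that $f_G$ has form (II) with parameters $(a,b)$ if $a>0$, $a^2-4b>0$, $x^2-ax+b$ is irreducible over $\mathbb Q$, $\lambda_1(G)$ is a root of $x^2-ax+b$, and for some integers $t_1,\dots,t_5\ge 0$ $$f_G(x)=x^{t_1}(x^2-1)^{t_2}(x^2-2)^{t_3}\big((x^2-x-1)(x^2+x-1)\big)^{t_4}(x^2-3)^{t_5}(x^2-ax+b)(x^2+ax+b).$$ Theorem. Let $T$ be a starlike tree that contains $K_{1,3}$ as a proper induced subgraph, and let $a,b\in\mathbb Z$. Then $T$ is quadratic and $f_T$ has form (II) with parameters $(a,b)$ if and only if $a>0$, $a^2-4b$ is not a perfect square, and, for some non-negative integers $n_i$,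 $T$ is (isomorphic to) one of the following: 1. $T_{0,0,1,0,n_5}$ with $n_5=\frac{b^2-3}{2}\ge 2$ and $2a^2=(b+2)^2+1$; 2. $T_{0,0,0,n_4}$ with $n_4=\frac{b^2-1}{2}\ge 3$ and $2a^2=(b+2)^2+1$; 3. $T_{2,0,0,n_4}$ with $n_4\ge 1$ and either $b=1$, $n_4=a^2-5$, or $b=-1$, $n_4=a^2-1$; 4. $T_{n_1,0,n_3}$ with $n_1=-a^2+(b+1)^2+1$, $n_3=2a^2-(b+2)^2\ge 1$ and $n_1+n_3\ge 3$; 5. $T_{n_1,n_2}$ with $n_1=b^2\ge 1$, $n_2=a^2-(b+1)^2\ge 1$ and $n_1+n_2\ge 3$. Moreover, under the conditions listed in the respective item (for any integers $a,b$ satisfying them), the characteristic polynomial is: 1. $f_T(x)=x^{n_5}(x^2-1)^{n_5-1}(x^2-x-1)(x^2+x-1)(x^2-3)^{n_5-1}(x^2-ax+b)(x^2+ax+b)$; 2. $f_T(x)=x\big((x^2-x-1)(x^2+x-1)\big)^{n_4-1}(x^2-ax+b)(x^2+ax+b)$; 3. $f_T(x)=x(x^2-2)\big((x^2-x-1)(x^2+x-1)\big)^{n_4-1}(x^2-ax+b)(x^2+ax+b)$;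 4. $f_T(x)=x^{n_1+n_3-1}(x^2-2)^{n_3-1}(x^2-ax+b)(x^2+ax+b)$; 5. $f_T(x)=x^{n_1-1}(x^2-1)^{n_2-1}(x^2-ax+b)(x^2+ax+b)$. -/

import Mathlib

open Polynomial

/-- The starlike tree `T_{n₁, …, n_k}`: a centre `none` together with, for every `i : Fin k`,
exactly `n i` pendant paths having `i + 1` vertices each (so `n 0` counts the paths `P₁`, `n 1`
counts the paths `P₂`, and so on). The vertex `some ⟨i, j, m⟩` is the `m`-th vertex, counted from
the centre, of the `j`-th path with `i + 1` vertices. -/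
def starlikeTree {k : ℕ} (n : Fin k → ℕ) :
    SimpleGraph (Option (Σ i : Fin k, Fin (n i) × Fin (i.val + 1))) where
  Adj u v :=
    match u, v with
    | none, none => False
    | none, some ⟨_, _, m⟩ => m.val = 0
    | some ⟨_, _, m⟩, none => m.val = 0
    | some ⟨i, j, m⟩, some ⟨i', j', m'⟩ =>
        i.val = i'.val ∧ j.val = j'.val ∧ (m.val + 1 = m'.val ∨ m'.val + 1 = m.val)
  symm := ⟨by
    rintro (_ | ⟨i, j, m⟩) (_ | ⟨i', j', m'⟩) h
    · exact h
    · exact h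
    · exact h
    · exact ⟨h.1.symm, h.2.1.symm, h.2.2.symm⟩⟩
  loopless := ⟨by
    rintro (_ | ⟨i, j, m⟩) h
    · exact h
    · rcases h.2.2 with h | h <;> omega⟩

/-- `G` is (isomorphic to) a starlike tree. -/
def IsStarlikeTree {V : Type*} (G : SimpleGraph V) : Prop :=
  ∃ (k : ℕ) (n : Fin k → ℕ), Nonempty (G ≃g starlikeTree n)

/-- `G` contains `K_{1,3}` as a proper induced subgraph. -/
def ProperlyContainsClaw {V : Type*} (G : SimpleGraph V) : Prop :=
  ∃ f : completeBipartiteGraph (Fin 1) (Fin 3) ↪g G, ¬ Function.Surjective f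

section

variable {V : Type*} [Fintype V] [DecidableEq V] (G : SimpleGraph V) [DecidableRel G.Adj]

/-- The characteristic polynomial `f_G(x) = det (x I - A(G))` of a graph. -/
noncomputable def graphCharpoly : ℤ[X] := (G.adjMatrix ℤ).charpoly

/-- The set of (necessarily real) eigenvalues of a graph: the zeros of `f_G`. -/
def graphEigenvalues : Set ℝ := {μ : ℝ | aeval μ (graphCharpoly G) = 0}

/-- A graph is quadratic if all its eigenvalues are algebraic integers of degree at most two. -/
def IsQuadraticGraph : Prop :=
  ∀ μ ∈ graphEigenvalues G, IsIntegral ℤ μ ∧ (minpoly ℤ μ).natDegree ≤ 2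

/-- The characteristic polynomial of `G` has form (II) with parameters `a` and `b`. -/
def HasFormII (a b : ℤ) : Prop :=
  0 < a ∧ 0 < a ^ 2 - 4 * b ∧ Irreducible (X ^ 2 - C a * X + C b : ℤ[X]) ∧
  (∃ ρ : ℝ, IsGreatest (graphEigenvalues G) ρ ∧ ρ ^ 2 - (a : ℝ) * ρ + (b : ℝ) = 0) ∧
  ∃ t₁ t₂ t₃ t₄ t₅ : ℕ,
    graphCharpoly G =
      X ^ t₁ * (X ^ 2 - 1) ^ t₂ * (X ^ 2 - 2) ^ t₃
        * ((X ^ 2 - X - 1) * (X ^ 2 + X - 1)) ^ t₄ * (X ^ 2 - 3) ^ t₅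
        * ((X ^ 2 - C a * X + C b) * (X ^ 2 + C a * X + C b))

end

/-- Restriction on `T_{0,0,1,0,n₅}`. -/
def Cond₁ (a b : ℤ) (n₅ : ℕ) : Prop :=
  2 * (n₅ : ℤ) = b ^ 2 - 3 ∧ 2 ≤ n₅ ∧ 2 * a ^ 2 = (b + 2) ^ 2 + 1

/-- Restriction on `T_{0,0,0,n₄}`. -/
def Cond₂ (a b : ℤ) (n₄ : ℕ) : Prop :=
  2 * (n₄ : ℤ) = b ^ 2 - 1 ∧ 3 ≤ n₄ ∧ 2 * a ^ 2 = (b + 2) ^ 2 + 1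

/-- Restriction on `T_{2,0,0,n₄}`. -/
def Cond₃ (a b : ℤ) (n₄ : ℕ) : Prop :=
  1 ≤ n₄ ∧ (((n₄ : ℤ) = a ^ 2 - 5 ∧ b = 1) ∨ ((n₄ : ℤ) = a ^ 2 - 1 ∧ b = -1))

/-- Restriction on `T_{n₁,0,n₃}`. -/
def Cond₄ (a b : ℤ) (n₁ n₃ : ℕ) : Prop :=
  (n₁ : ℤ) = -a ^ 2 + (b + 1) ^ 2 + 1 ∧ (n₃ : ℤ) = 2 * a ^ 2 - (b + 2) ^ 2 ∧
    1 ≤ n₃ ∧ 3 ≤ n₁ + n₃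

/-- Restriction on `T_{n₁,n₂}`. -/
def Cond₅ (a b : ℤ) (n₁ n₂ : ℕ) : Prop :=
  (n₁ : ℤ) = b ^ 2 ∧ 1 ≤ n₁ ∧ (n₂ : ℤ) = a ^ 2 - (b + 1) ^ 2 ∧ 1 ≤ n₂ ∧ 3 ≤ n₁ + n₂

/-! ### Determinants of bordered and block diagonal matrices -/

/-! Write `P_j` for the characteristic polynomial of the path on `j` vertices. Expanding along the
centre gives `f_T = ∏ P_i^{n_i} · (x - ∑ n_i P_{i-1}/P_i)`. At `x = 2 cos θ` the second factor is
`sin θ` times a combination of cotangents (`secular`). Its poles in `(0, π)` are the multiples of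
`π/(i+1)` for the path lengths `i` that occur, and it runs from `+∞` to `-∞` between consecutive
poles. Hence an eigenvalue of `T` that belongs to no branch lies strictly between any two poles
(`exists_secular_zero`).

Form (II) leaves little room for these eigenvalues. Those in `(0, 2)` below the largest eigenvalue
`ρ` are `1`, `√2`, `√3`, the golden ratio, its inverse, and at most one more, `|a - ρ|`, where `a -
ρ` is the conjugate of `ρ` (`isSpecialAngle_or`). Two gaps avoiding the five special angles
therefore contradict each other; this bounds the branch lengths (`HasGaps.branch_bound`). When a gap
is filled by a special angle, the secular equation there becomes a linear Diophantine equation in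
the multiplicities, because path values at such a point are periodic up to a factor
(`IsNewAngle.third_eq` and its companions). Together with the existence of at least three branches,
forced by the claw, this leaves nine shapes with branches of at most five vertices
(`HasGaps.shortBranches`).

For each shape the secular equation at `ρ` is a monic polynomial equation in `ρ²`. Degree one is
impossible, and in degree two it must be `(x² - ax + b)(x² + ax + b)`; comparing coefficients gives
the five parameter families (`admissible_of_short`).

Conversely, the product formula gives the characteristic polynomials of the families explicitly, and
`quadratic_and_formII` checks that the largest root belongs to `x² - ax + b`. -/

lemma det_bordered {R α : Type*} [CommRing R] [Fintype α] [DecidableEq α]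
    (M : Matrix (Option α) (Option α) R) (v : α → R)
    (hv : ∀ i, ∑ j, M (some i) (some j) * v j = -M (some i) none) :
    M.det = (M.submatrix some some).det * (M none none + ∑ j, M none (some j) * v j) := by
  set e := Equiv.optionEquivSumPUnit.{0} α with he
  -- Right multiplication by a unipotent matrix adds the combination `v` of the other columns to the
  -- border column, leaving a Schur complement in the corner.
  have h1 : (M.submatrix e.symm e.symm) * Matrix.fromBlocks 1 (Matrix.of fun i _ => v i) 0 1 =
      Matrix.fromBlocks (M.submatrix some some) 0 (Matrix.of fun _ j => M none (some j))
        (Matrix.of fun _ _ => M none none + ∑ j, M none (some j) * v j) := by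
    ext (i | i) (j | j)
    · simp [Matrix.mul_apply, he, Matrix.one_apply]
    · simp [Matrix.mul_apply, he, hv]
    · simp [Matrix.mul_apply, he, Matrix.one_apply]
    · simp [Matrix.mul_apply, he, add_comm]
  have h2 := congrArg Matrix.det h1
  rw [Matrix.det_mul, Matrix.det_submatrix_equiv_self, Matrix.det_fromBlocks_zero₂₁,
    Matrix.det_fromBlocks_zero₁₂] at h2
  simpa using h2

/-! ### Characteristic polynomials of paths -/

/-- `pathU (m + 1)` is the characteristic polynomial of the path on `m` vertices. -/
noncomputable def pathU : ℕ → ℤ[X]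
  | 0 => 0
  | 1 => 1
  | n + 2 => X * pathU (n + 1) - pathU n

/-- The value of `pathU n` at a real number. -/
noncomputable def pathVal (x : ℝ) (n : ℕ) : ℝ := aeval x (pathU n)

@[simp] lemma pathVal_zero (x : ℝ) : pathVal x 0 = 0 := by simp [pathVal, pathU]
@[simp] lemma pathVal_one (x : ℝ) : pathVal x 1 = 1 := by simp [pathVal, pathU]
lemma pathVal_add_two (x : ℝ) (n : ℕ) :
    pathVal x (n + 2) = x * pathVal x (n + 1) - pathVal x n := by simp [pathVal, pathU]

lemma pathVal_lt_succ {x : ℝ} (hx : 2 ≤ x) (n : ℕ) :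
    0 ≤ pathVal x n ∧ pathVal x n + 1 ≤ pathVal x (n + 1) := by
  induction n with
  | zero => simp
  | succ n ih =>
    refine ⟨by linarith, ?_⟩
    rw [pathVal_add_two]
    nlinarith

lemma pathVal_pos_of_two_le {x : ℝ} (hx : 2 ≤ x) (n : ℕ) : 0 < pathVal x (n + 1) := by
  have := pathVal_lt_succ hx n
  linarith

lemma pathVal_two_mul_cos (θ : ℝ) (n : ℕ) :
    pathVal (2 * Real.cos θ) n * Real.sin θ = Real.sin (n * θ) := by
  induction n using Nat.twoStepInduction with
  | zero => simp
  | one => simp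
  | more n ih1 ih2 =>
    rw [pathVal_add_two, sub_mul, ih1, mul_assoc, ih2]
    push_cast
    have e1 : ((n : ℝ) + 2) * θ = (n + 1) * θ + θ := by ring
    have e2 : (n : ℝ) * θ = (n + 1) * θ - θ := by ring
    rw [e1, e2, Real.sin_add, Real.sin_sub]
    ring

/-- The matrix `x I - A` of the path on `m` vertices. -/
def pathMatrix (x : ℝ) (m : ℕ) : Matrix (Fin m) (Fin m) ℝ :=
  Matrix.of fun i j => (if i.val = j.val then x else 0) -
    (if i.val + 1 = j.val ∨ j.val + 1 = i.val then 1 else 0)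

/-- By the three-term recurrence, the path values read backwards form a multiple of the first column
of the inverse of `xI - A`. This is the vector needed in `det_bordered` when a path is attached by
its end vertex. -/
lemma sum_pathMatrix_mul (x : ℝ) (m : ℕ) (i : Fin m) :
    ∑ j : Fin m, pathMatrix x m i j * pathVal x (m - j) = if i.val = 0 then pathVal x (m + 1) else 0 := by
  have h0 : ∀ j : Fin m, pathMatrix x m i j * pathVal x (m - j) =
      (fun j : ℕ => (if i.val = j then x * pathVal x (m - j) else 0) -
        (if i.val + 1 = j then pathVal x (m - j) else 0) -
        (if i.val = j + 1 then pathVal x (m - j) else 0)) j := by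
    intro j
    simp only [pathMatrix, Matrix.of_apply]
    split_ifs <;> first | omega | ring
  rw [Finset.sum_congr rfl fun j _ => h0 j, Fin.sum_univ_eq_sum_range (fun j : ℕ =>
    (if i.val = j then x * pathVal x (m - j) else 0) -
        (if i.val + 1 = j then pathVal x (m - j) else 0) -
        (if i.val = j + 1 then pathVal x (m - j) else 0)) m]
  rw [Finset.sum_sub_distrib, Finset.sum_sub_distrib, Finset.sum_ite_eq, Finset.sum_ite_eq]
  obtain ⟨i, hi⟩ := i
  obtain ⟨d, rfl⟩ : ∃ d, m = i + d + 1 := ⟨m - i - 1, by omega⟩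
  simp only [Finset.mem_range]
  have e1 : i + d + 1 - i = d + 1 := by omega
  have e2 : i + d + 1 - (i + 1) = d := by omega
  rw [e1, e2, if_pos (by omega)]
  -- The last vertex has no right neighbour; the missing term is harmless because `pathVal x 0 = 0`.
  have e3 : (if i + 1 < i + d + 1 then pathVal x d else 0) = pathVal x d := by
    split_ifs with h
    · rfl
    · obtain rfl : d = 0 := by omega
      simp
  rw [e3]
  cases i with
  | zero => simp [pathVal_add_two]
  | succ i =>
    have : ∀ j : ℕ, (i + 1 = j + 1) ↔ i = j := by omega
    simp only [this]
    rw [Finset.sum_ite_eq (Finset.range (i + 1 + d + 1)), if_pos (by simp; omega)]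
    have e4 : i + 1 + d + 1 - i = d + 2 := by omega
    rw [e4, pathVal_add_two]
    simp

/-- Induction removes the first vertex by `det_bordered`. The bound `2 ≤ x` only serves to divide by
a nonzero path value, and a half-line is enough to determine a polynomial later. -/
lemma det_pathMatrix {x : ℝ} (hx : 2 ≤ x) (m : ℕ) : (pathMatrix x m).det = pathVal x (m + 1) := by
  induction m with
  | zero => simp
  | succ m ih =>
    have hpos := pathVal_pos_of_two_le hx m
    rw [← Matrix.det_submatrix_equiv_self (finSuccEquiv m).symm,
      det_bordered _ (fun j : Fin m => pathVal x (m - j) / pathVal x (m + 1))]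
    · have h1 : ((pathMatrix x (m + 1)).submatrix (finSuccEquiv m).symm
          (finSuccEquiv m).symm).submatrix some some = pathMatrix x m := by
        ext i j
        simp [pathMatrix]
      rw [h1, ih]
      have h2 : ∑ j : Fin m, ((pathMatrix x (m + 1)).submatrix (finSuccEquiv m).symm
          (finSuccEquiv m).symm) none (some j) * (pathVal x (m - j) / pathVal x (m + 1)) =
          - (pathVal x m / pathVal x (m + 1)) := by
        cases m with
        | zero => simp
        | succ m =>
          rw [Fin.sum_univ_succ]
          simp [pathMatrix]
      rw [h2]
      simp only [Matrix.submatrix_apply, finSuccEquiv_symm_none]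
      rw [pathVal_add_two]
      simp only [pathMatrix, Matrix.of_apply]
      field_simp
      simp
      ring
    · intro i
      have h3 : ∀ j : Fin m, ((pathMatrix x (m + 1)).submatrix (finSuccEquiv m).symm
          (finSuccEquiv m).symm) (some i) (some j) = pathMatrix x m i j := by
        intro j
        simp [pathMatrix]
      simp only [h3, ← mul_div_assoc]
      rw [← Finset.sum_div, sum_pathMatrix_mul]
      by_cases hi : i.val = 0
      · simp [hi, pathMatrix, div_self hpos.ne']
      · simp [hi, pathMatrix]

/-! ### The characteristic polynomial of a starlike tree -/

lemma graphCharpoly_iso {V W : Type*} [Fintype V] [DecidableEq V] [Fintype W] [DecidableEq W]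
    {G : SimpleGraph V} {H : SimpleGraph W} [DecidableRel G.Adj] [DecidableRel H.Adj]
    (e : G ≃g H) : graphCharpoly G = graphCharpoly H := by
  unfold graphCharpoly
  rw [← Matrix.charpoly_reindex e.toEquiv (G.adjMatrix ℤ)]
  congr 1
  ext i j
  simp only [Matrix.reindex_apply, Matrix.submatrix_apply, SimpleGraph.adjMatrix_apply]
  have : G.Adj (e.toEquiv.symm i) (e.toEquiv.symm j) ↔ H.Adj i j := by
    have h (i : W) : e (e.toEquiv.symm i) = i := e.toEquiv.apply_symm_apply i
    rw [← e.map_adj_iff, h, h]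
  simp only [this]

lemma aeval_graphCharpoly {V : Type*} [Fintype V] [DecidableEq V] (G : SimpleGraph V)
    [DecidableRel G.Adj] (x : ℝ) :
    aeval x (graphCharpoly G) = (Matrix.scalar V x - G.adjMatrix ℝ).det := by
  unfold graphCharpoly
  rw [← Matrix.eval_charpoly, aeval_def, ← eval_map, ← Matrix.charpoly_map]
  congr 2
  ext i j
  simp only [Matrix.map_apply, SimpleGraph.adjMatrix_apply]
  split_ifs <;> simp

lemma monic_graphCharpoly {V : Type*} [Fintype V] [DecidableEq V] (G : SimpleGraph V)
    [DecidableRel G.Adj] : (graphCharpoly G).Monic := Matrix.charpoly_monic _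

section Starlike

variable {k : ℕ} (n : Fin k → ℕ)

/-- The matrix `x I - A` of the union of the paths of a starlike tree. -/
def branchMatrix (x : ℝ) : Matrix (Σ i : Fin k, Fin (n i) × Fin (i.val + 1))
    (Σ i : Fin k, Fin (n i) × Fin (i.val + 1)) ℝ :=
  Matrix.of fun u v => if u.1.val = v.1.val ∧ u.2.1.val = v.2.1.val then
    (if u.2.2.val = v.2.2.val then x else 0) -
      (if u.2.2.val + 1 = v.2.2.val ∨ v.2.2.val + 1 = u.2.2.val then 1 else 0) else 0

/-- Entries between different paths vanish, so any linear ordering of the paths, here `e`, makes the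
matrix block triangular with path matrices as diagonal blocks. -/
lemma det_branchMatrix {x : ℝ} (hx : 2 ≤ x) :
    (branchMatrix n x).det = ∏ i : Fin k, pathVal x (i.val + 2) ^ n i := by
  let e := Fintype.equivFin (Σ i : Fin k, Fin (n i))
  have hb : (branchMatrix n x).BlockTriangular (fun u => e ⟨u.1, u.2.1⟩) := by
    rintro ⟨i, j, m⟩ ⟨i', j', m'⟩ h
    simp only [branchMatrix, Matrix.of_apply]
    rw [if_neg]
    rintro ⟨h1, h2⟩
    obtain rfl := Fin.ext h1
    obtain rfl := Fin.ext h2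
    exact lt_irrefl _ h
  rw [hb.det_fintype, ← e.prod_comp, Fintype.prod_sigma]
  refine Finset.prod_congr rfl fun i _ => ?_
  have key : ∀ j : Fin (n i), ((branchMatrix n x).toSquareBlock (fun u => e ⟨u.1, u.2.1⟩)
      (e ⟨i, j⟩)).det = pathVal x (i.val + 2) := by
    intro j
    let f : Fin (i.val + 1) ≃ {u : Σ i : Fin k, Fin (n i) × Fin (i.val + 1) //
        e ⟨u.1, u.2.1⟩ = e ⟨i, j⟩} := Equiv.ofBijective (fun m => ⟨⟨i, j, m⟩, rfl⟩) (by
      constructor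
      · intro m m' h
        simpa using h
      · rintro ⟨⟨i', j', m'⟩, h⟩
        have h' : (⟨i', j'⟩ : Σ i : Fin k, Fin (n i)) = ⟨i, j⟩ := e.injective h
        cases h'
        exact ⟨m', rfl⟩)
    rw [← Matrix.det_submatrix_equiv_self f, ← det_pathMatrix hx]
    congr 1
    ext m m'
    have hf (m : Fin (i.val + 1)) : (f m).1 = ⟨i, j, m⟩ := rfl
    change branchMatrix n x (f m).1 (f m').1 = _
    rw [hf, hf]
    simp [branchMatrix, pathMatrix]
  simp [key]

lemma sum_branchMatrix_mul (x : ℝ) (g : Fin k → ℕ → ℝ) (i : Fin k) (j : Fin (n i))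
    (m : Fin (i.val + 1)) :
    ∑ v, branchMatrix n x ⟨i, j, m⟩ v * g v.1 v.2.2.val =
      ∑ m' : Fin (i.val + 1), pathMatrix x (i.val + 1) m m' * g i m'.val := by
  rw [Fintype.sum_sigma, Finset.sum_eq_single i, Fintype.sum_prod_type, Finset.sum_eq_single j]
  · refine Finset.sum_congr rfl fun m' _ => ?_
    simp [branchMatrix, pathMatrix]
  · intro j' _ hj
    refine Finset.sum_eq_zero fun m' _ => ?_
    have : ¬ (j.val = j'.val) := fun h => hj (Fin.ext h.symm)
    simp [branchMatrix, this]
  · simp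
  · intro i' _ hi
    refine Finset.sum_eq_zero fun m' _ => ?_
    have : ¬ (i.val = i'.val) := fun h => hi (Fin.ext h.symm)
    simp [branchMatrix, this]
  · simp

/-- Clears the denominators of the secular sum. The truncated exponent `n i - 1` does no harm, since
its term carries the factor `n i`. -/
lemma prod_mul_sum_div (p q : Fin k → ℝ) (hq : ∀ i, 0 < n i → q i ≠ 0) :
    (∏ i, q i ^ n i) * ∑ i, n i * (p i / q i) =
      ∑ i, n i * p i * q i ^ (n i - 1) * ∏ j ∈ Finset.univ.erase i, q j ^ n j := by
  rw [Finset.mul_sum]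
  refine Finset.sum_congr rfl fun i _ => ?_
  rw [← Finset.mul_prod_erase _ _ (Finset.mem_univ i)]
  rcases Nat.eq_zero_or_pos (n i) with h | h
  · simp [h]
  · have h1 := hq i h
    obtain ⟨d, hd⟩ : ∃ d, n i = d + 1 := ⟨n i - 1, by omega⟩
    rw [hd, Nat.add_sub_cancel, pow_succ]
    field_simp

variable [DecidableRel (starlikeTree n).Adj]

lemma aeval_starlike_of_two_le {x : ℝ} (hx : 2 ≤ x) :
    aeval x (graphCharpoly (starlikeTree n)) = (∏ i : Fin k, pathVal x (i.val + 2) ^ n i) *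
      (x - ∑ i : Fin k, n i * (pathVal x (i.val + 1) / pathVal x (i.val + 2))) := by
  rw [aeval_graphCharpoly]
  set M : Matrix (Option (Σ i : Fin k, Fin (n i) × Fin (i.val + 1)))
    (Option (Σ i : Fin k, Fin (n i) × Fin (i.val + 1))) ℝ :=
    Matrix.scalar _ x - (starlikeTree n).adjMatrix ℝ with hM
  have hsub : M.submatrix some some = branchMatrix n x := by
    ext ⟨i, j, m⟩ ⟨i', j', m'⟩
    simp only [Matrix.submatrix_apply, hM, Matrix.sub_apply, SimpleGraph.adjMatrix_apply,
      Matrix.scalar_apply, Matrix.diagonal_apply, branchMatrix, Matrix.of_apply]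
    have hadj : (starlikeTree n).Adj (some ⟨i, j, m⟩) (some ⟨i', j', m'⟩) ↔
      (i.val = i'.val ∧ j.val = j'.val ∧ (m.val + 1 = m'.val ∨ m'.val + 1 = m.val)) := Iff.rfl
    have heq : (some ⟨i, j, m⟩ : Option (Σ i : Fin k, Fin (n i) × Fin (i.val + 1))) =
        some ⟨i', j', m'⟩ ↔ i.val = i'.val ∧ j.val = j'.val ∧ m.val = m'.val := by
      constructor
      · rintro h
        cases h
        simp
      · rintro ⟨h1, h2, h3⟩
        obtain rfl := Fin.ext h1
        obtain rfl := Fin.ext h2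
        obtain rfl := Fin.ext h3
        rfl
    simp only [hadj, heq]
    by_cases h1 : i.val = i'.val <;> by_cases h2 : j.val = j'.val <;> simp [h1, h2]
  rw [det_bordered M
    (fun v => pathVal x (v.1.val + 1 - v.2.2.val) / pathVal x (v.1.val + 2))]
  · have hone : M none none = x := by
      simp [hM]
    have hrow : ∀ v, M none (some v) =
        if v.2.2.val = 0 then -1 else 0 := by
      rintro ⟨i, j, m⟩
      have hadj : (starlikeTree n).Adj none (some ⟨i, j, m⟩) ↔ m.val = 0 := Iff.rfl
      simp only [hM, Matrix.sub_apply, SimpleGraph.adjMatrix_apply, hadj]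
      split_ifs <;> simp
    rw [hsub, det_branchMatrix n hx, hone]
    simp only [hrow]
    congr 1
    rw [sub_eq_add_neg, Fintype.sum_sigma, ← Finset.sum_neg_distrib]
    congr 1
    refine Finset.sum_congr rfl fun i _ => ?_
    rw [Fintype.sum_prod_type]
    simp only [Fin.sum_univ_succ]
    simp
  · rintro ⟨i, j, m⟩
    have hcol : M (some ⟨i, j, m⟩) none =
        if m.val = 0 then -1 else 0 := by
      have hadj : (starlikeTree n).Adj (some ⟨i, j, m⟩) none ↔ m.val = 0 := Iff.rfl
      simp only [hM, Matrix.sub_apply, SimpleGraph.adjMatrix_apply, hadj]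
      split_ifs <;> simp
    have hsub' : ∀ v, M (some ⟨i, j, m⟩) (some v) =
        branchMatrix n x ⟨i, j, m⟩ v := by
      intro v
      rw [← hsub]
      rfl
    simp only [hsub']
    rw [sum_branchMatrix_mul n x
      (fun i m' => pathVal x (i.val + 1 - m') / pathVal x (i.val + 2)) i j m, hcol]
    simp only [← mul_div_assoc]
    rw [← Finset.sum_div, sum_pathMatrix_mul]
    have := (pathVal_pos_of_two_le hx (i.val + 1)).ne'
    split_ifs
    · simp [div_self this]
    · simp

/-- On `[2, ∞)` no path polynomial in a denominator vanishes, so the rational formula holds there;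
infinitely many points give the polynomial identity. -/
theorem graphCharpoly_starlikeTree :
    graphCharpoly (starlikeTree n) = X * (∏ i : Fin k, pathU (i.val + 2) ^ n i) -
      ∑ i : Fin k, (n i : ℤ[X]) * pathU (i.val + 1) * pathU (i.val + 2) ^ (n i - 1) *
        ∏ j ∈ Finset.univ.erase i, pathU (j.val + 2) ^ n j := by
  apply Polynomial.map_injective (Int.castRingHom ℝ) Int.cast_injective
  refine Polynomial.eq_of_infinite_eval_eq _ _ ((Set.Ici_infinite (2 : ℝ)).mono fun x hx => ?_)
  have hx : 2 ≤ x := hx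
  have key := aeval_starlike_of_two_le n hx
  rw [mul_sub, prod_mul_sum_div n (fun i => pathVal x (i.val + 1)) (fun i => pathVal x (i.val + 2))
    fun i _ => (pathVal_pos_of_two_le hx (i.val + 1)).ne'] at key
  simp only [Set.mem_ofPred_eq, eval_map]
  rw [← algebraMap_int_eq, ← aeval_def, key, ← aeval_def]
  simp [pathVal, map_prod, mul_comm]

lemma aeval_starlike {x : ℝ} (hx : ∀ i, 0 < n i → pathVal x (i.val + 2) ≠ 0) :
    aeval x (graphCharpoly (starlikeTree n)) = (∏ i : Fin k, pathVal x (i.val + 2) ^ n i) *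
      (x - ∑ i : Fin k, n i * (pathVal x (i.val + 1) / pathVal x (i.val + 2))) := by
  rw [mul_sub, prod_mul_sum_div n (fun i => pathVal x (i.val + 1)) (fun i => pathVal x (i.val + 2))
    hx, graphCharpoly_starlikeTree]
  simp [pathVal, map_prod, mul_comm]

/-- With two copies of a branch, every term of the cleared formula retains a factor `pathU (i + 2)`.
-/
lemma aeval_starlike_eq_zero {x : ℝ} {i : Fin k} (hi : 2 ≤ n i) (hx : pathVal x (i.val + 2) = 0) :
    aeval x (graphCharpoly (starlikeTree n)) = 0 := by
  have h0 : aeval x (pathU (i.val + 2)) = 0 := hx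
  rw [graphCharpoly_starlikeTree]
  simp only [map_sub, map_mul, map_prod, map_sum, map_pow, aeval_X, map_natCast]
  rw [Finset.prod_eq_zero (Finset.mem_univ i) (by rw [h0, zero_pow (by omega)]),
    Finset.sum_eq_zero]
  · simp
  · intro j _
    rcases eq_or_ne j i with rfl | hj
    · rw [h0, zero_pow (by omega)]
      simp
    · rw [Finset.prod_eq_zero (Finset.mem_erase.2 ⟨hj.symm, Finset.mem_univ i⟩)
        (by rw [h0, zero_pow (by omega)])]
      simp

end Starlike

/-! ### Isomorphisms between starlike trees, and claws in them -/

/-- The number of branches of `starlikeTree n` having `i + 1` vertices. -/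
def branchCount {k : ℕ} (n : Fin k → ℕ) (i : ℕ) : ℕ := if h : i < k then n ⟨i, h⟩ else 0

lemma branchCount_val {k : ℕ} (n : Fin k → ℕ) (i : Fin k) : branchCount n i.val = n i := by
  simp [branchCount]

lemma lt_of_branchCount_pos {k : ℕ} {n : Fin k → ℕ} {i : ℕ} (h : 0 < branchCount n i) : i < k := by
  by_contra hk
  simp [branchCount, hk] at h

/-- The map between starlike trees which have the same branches. -/
def starlikeMap {k k' : ℕ} (n : Fin k → ℕ) (n' : Fin k' → ℕ)
    (h : ∀ i, branchCount n i = branchCount n' i) :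
    Option (Σ i : Fin k, Fin (n i) × Fin (i.val + 1)) →
      Option (Σ i : Fin k', Fin (n' i) × Fin (i.val + 1))
  | none => none
  | some ⟨i, j, m⟩ =>
    have hi : branchCount n' i.val = n i := by rw [← h, branchCount_val]
    have hk : i.val < k' := lt_of_branchCount_pos (n := n') (by rw [hi]; exact j.pos)
    some ⟨⟨i.val, hk⟩, ⟨j.val, by rw [← branchCount_val n', hi]; exact j.isLt⟩, m⟩

lemma nonempty_starlikeTree_iso {k k' : ℕ} (n : Fin k → ℕ) (n' : Fin k' → ℕ)
    (h : ∀ i, branchCount n i = branchCount n' i) :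
    Nonempty (starlikeTree n ≃g starlikeTree n') := by
  refine ⟨⟨⟨starlikeMap n n' h, starlikeMap n' n fun i => (h i).symm, ?_, ?_⟩, ?_⟩⟩
  · rintro (_ | ⟨i, j, m⟩) <;> rfl
  · rintro (_ | ⟨i, j, m⟩) <;> rfl
  · rintro (_ | ⟨i, j, m⟩) (_ | ⟨i', j', m'⟩) <;> exact Iff.rfl

/-- The distance from the centre of a starlike tree. -/
def starlikeDepth {k : ℕ} (n : Fin k → ℕ) :
    Option (Σ i : Fin k, Fin (n i) × Fin (i.val + 1)) → ℕ
  | none => 0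
  | some ⟨_, _, m⟩ => m.val + 1

lemma starlike_neighbor {k : ℕ} (n : Fin k → ℕ) (i : Fin k) (j : Fin (n i)) (m : Fin (i.val + 1))
    (v : Option (Σ i : Fin k, Fin (n i) × Fin (i.val + 1)))
    (hv : (starlikeTree n).Adj (some ⟨i, j, m⟩) v) :
    (m.val = 0 ∧ v = none) ∨ ∃ m' : Fin (i.val + 1), (m.val + 1 = m'.val ∨ m'.val + 1 = m.val) ∧
      v = some ⟨i, j, m'⟩ := by
  rcases v with _ | ⟨i', j', m'⟩
  · exact Or.inl ⟨hv, rfl⟩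
  · obtain ⟨h1, h2, h3⟩ : i.val = i'.val ∧ j.val = j'.val ∧
      (m.val + 1 = m'.val ∨ m'.val + 1 = m.val) := hv
    obtain rfl := Fin.ext h1
    obtain rfl := Fin.ext h2
    exact Or.inr ⟨m', h3, rfl⟩

/-- A vertex other than the centre has at most two neighbours, one on each side and distinguished by
depth. The claw is thus centred at the centre of the tree, and its leaves start three different
branches. -/
lemma three_le_of_claw {V : Type*} {T : SimpleGraph V} (hT : ProperlyContainsClaw T) {k : ℕ}
    {n : Fin k → ℕ} (e : T ≃g starlikeTree n) : 3 ≤ ∑ i, n i := by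
  obtain ⟨f, -⟩ := hT
  set g : Fin 3 → _ := fun t => e (f (Sum.inr t)) with hg
  have hinj : Function.Injective g := fun s t h => by
    simpa using f.injective (e.injective h)
  have hadj : ∀ t, (starlikeTree n).Adj (e (f (Sum.inl 0))) (g t) := by
    intro t
    rw [hg, e.map_adj_iff, f.map_adj_iff]
    simp
  generalize e (f (Sum.inl 0)) = c at hadj
  rcases c with _ | ⟨i, j, m⟩
  · have h1 : ∀ t, ∃ p : Σ i : Fin k, Fin (n i), g t = some ⟨p.1, p.2, 0⟩ := by
      intro t
      have h := hadj t
      rcases hgt : g t with _ | ⟨i, j, m⟩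
      · rw [hgt] at h
        exact h.elim
      · rw [hgt] at h
        have hm : m.val = 0 := h
        exact ⟨⟨i, j⟩, by rw [show m = 0 from Fin.ext hm]⟩
    choose p hp using h1
    have hpinj : Function.Injective p := fun s t h => hinj (by rw [hp, hp, h])
    simpa using Fintype.card_le_of_injective p hpinj
  · exfalso
    have hd : ∀ t, starlikeDepth n (g t) = m.val ∨ starlikeDepth n (g t) = m.val + 2 := by
      intro t
      rcases starlike_neighbor n i j m _ (hadj t) with ⟨h1, h2⟩ | ⟨m', h1, h2⟩
      · rw [h2]
        simp [starlikeDepth, h1]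
      · rw [h2]
        simp only [starlikeDepth]
        omega
    have hdinj : ∀ s t, starlikeDepth n (g s) = starlikeDepth n (g t) → s = t := by
      intro s t h
      apply hinj
      rcases starlike_neighbor n i j m _ (hadj s) with ⟨h1, h2⟩ | ⟨m', h1, h2⟩ <;>
      rcases starlike_neighbor n i j m _ (hadj t) with ⟨h3, h4⟩ | ⟨m'', h3, h4⟩ <;>
      rw [h2, h4] at h ⊢ <;> simp only [starlikeDepth] at h
      · omega
      · omega
      · rw [show m' = m'' from Fin.ext (by omega)]
    have h01 := mt (hdinj 0 1) (by decide)
    have h02 := mt (hdinj 0 2) (by decide)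
    have h12 := mt (hdinj 1 2) (by decide)
    rcases hd 0 with h0 | h0 <;> rcases hd 1 with h1 | h1 <;> rcases hd 2 with h2 | h2 <;> omega

/-! ### The secular function of a starlike tree -/

-- Since `sin (m θ₀) = 0`, the cotangent of `m θ` equals that of `m (θ - θ₀)`, which reduces the
-- claim to the behaviour at `0`.
open Filter Topology in
lemma tendsto_cos_div_sin_right {m θ₀ : ℝ} (hm : 0 < m) (h : Real.sin (m * θ₀) = 0) :
    Tendsto (fun θ => Real.cos (m * θ) / Real.sin (m * θ)) (𝓝[>] θ₀) atTop := by
  have hcos : Real.cos (m * θ₀) ≠ 0 := by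
    intro h'
    have := Real.sin_sq_add_cos_sq (m * θ₀)
    simp [h, h'] at this
  have key : ∀ θ, Real.cos (m * θ) / Real.sin (m * θ) =
      Real.cos (m * (θ - θ₀)) * (Real.sin (m * (θ - θ₀)))⁻¹ := by
    intro θ
    have : m * θ = m * θ₀ + m * (θ - θ₀) := by ring
    rw [this, Real.cos_add, Real.sin_add, h, zero_mul, zero_mul, sub_zero, zero_add,
      mul_div_mul_left _ _ hcos, div_eq_mul_inv]
  simp only [key]
  have hlin : Tendsto (fun θ => m * (θ - θ₀)) (𝓝[>] θ₀) (𝓝[>] 0) := by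
    refine tendsto_nhdsWithin_iff.2 ⟨?_, ?_⟩
    · have : Continuous fun θ => m * (θ - θ₀) := by fun_prop
      simpa using (this.tendsto θ₀).mono_left nhdsWithin_le_nhds
    · filter_upwards [self_mem_nhdsWithin] with θ hθ
      exact mul_pos hm (sub_pos.2 hθ)
  have hsin : Tendsto Real.sin (𝓝[>] 0) (𝓝[>] 0) := by
    refine tendsto_nhdsWithin_iff.2 ⟨?_, ?_⟩
    · simpa using (Real.continuous_sin.tendsto 0).mono_left nhdsWithin_le_nhds
    · filter_upwards [Ioo_mem_nhdsGT Real.pi_pos] with θ hθ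
      exact Real.sin_pos_of_mem_Ioo hθ
  have hcos' : Tendsto Real.cos (𝓝[>] 0) (𝓝 1) := by
    simpa using (Real.continuous_cos.tendsto 0).mono_left nhdsWithin_le_nhds
  exact Tendsto.pos_mul_atTop one_pos (hcos'.comp hlin)
    ((tendsto_inv_nhdsGT_zero.comp hsin).comp hlin)

section Secular

variable {k : ℕ} (n : Fin k → ℕ)

/-- `θ` is a pole when `2 cos θ` is an eigenvalue of some branch. -/
def IsPole (θ : ℝ) : Prop := ∃ i : Fin k, 0 < n i ∧ Real.sin ((i.val + 2 : ℕ) * θ) = 0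

/-- Up to the factor `sin θ`, the ratio of the characteristic polynomial of a starlike tree to that
of the union of its branches, at `2 cos θ`. -/
noncomputable def secular (θ : ℝ) : ℝ :=
  (2 - ∑ i, (n i : ℝ)) * (Real.cos θ / Real.sin θ) +
    ∑ i : Fin k, n i * (Real.cos ((i.val + 2 : ℕ) * θ) / Real.sin ((i.val + 2 : ℕ) * θ))

lemma secular_neg (θ : ℝ) : secular n (-θ) = -secular n θ := by
  simp only [secular, mul_neg, Real.cos_neg, Real.sin_neg, div_neg, Finset.sum_neg_distrib]
  ring

lemma isPole_neg {θ : ℝ} : IsPole n (-θ) ↔ IsPole n θ := by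
  simp [IsPole]

lemma continuousAt_secular {θ : ℝ} (hθ : Real.sin θ ≠ 0) (hp : ¬ IsPole n θ) :
    ContinuousAt (secular n) θ := by
  unfold secular
  refine ContinuousAt.add (ContinuousAt.mul continuousAt_const
    (ContinuousAt.div Real.continuous_cos.continuousAt Real.continuous_sin.continuousAt hθ))
    (tendsto_finsetSum _ fun i _ => ?_)
  rcases Nat.eq_zero_or_pos (n i) with h | h
  · simp [h]
  · have h1 : Real.sin ((i.val + 2 : ℕ) * θ) ≠ 0 := fun h' => hp ⟨i, h, h'⟩
    exact ContinuousAt.mul continuousAt_const (ContinuousAt.div (by fun_prop) (by fun_prop) h1)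

open Filter Topology in
lemma tendsto_secular_right {θ₀ : ℝ} (hs : Real.sin θ₀ ≠ 0) (hp : IsPole n θ₀) :
    Tendsto (secular n) (𝓝[>] θ₀) atTop := by
  obtain ⟨i₀, hi₀, h₀⟩ := hp
  have hbdd : ∀ i : Fin k, ∃ C : ℝ, ∀ᶠ θ in 𝓝[>] θ₀, C ≤ n i *
      (Real.cos ((i.val + 2 : ℕ) * θ) / Real.sin ((i.val + 2 : ℕ) * θ)) := by
    intro i
    by_cases hi : Real.sin ((i.val + 2 : ℕ) * θ₀) = 0
    · refine ⟨0, ?_⟩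
      filter_upwards [(tendsto_cos_div_sin_right (by positivity) hi).eventually_ge_atTop 0] with θ h
      positivity
    · have hc : ContinuousAt (fun θ => n i * (Real.cos ((i.val + 2 : ℕ) * θ) /
          Real.sin ((i.val + 2 : ℕ) * θ))) θ₀ :=
        ContinuousAt.mul continuousAt_const (ContinuousAt.div (by fun_prop) (by fun_prop) hi)
      refine ⟨_, (Tendsto.eventually_const_lt (sub_one_lt _)
        (hc.tendsto.mono_left nhdsWithin_le_nhds)).mono fun θ h => h.le⟩
  choose C hC using hbdd
  have hmain : Tendsto (fun θ => n i₀ * (Real.cos ((i₀.val + 2 : ℕ) * θ) /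
      Real.sin ((i₀.val + 2 : ℕ) * θ))) (𝓝[>] θ₀) atTop :=
    (tendsto_cos_div_sin_right (by positivity) h₀).const_mul_atTop (by exact_mod_cast hi₀)
  have hc : ContinuousAt (fun θ => (2 - ∑ i, (n i : ℝ)) * (Real.cos θ / Real.sin θ)) θ₀ :=
    ContinuousAt.mul continuousAt_const
      (ContinuousAt.div Real.continuous_cos.continuousAt Real.continuous_sin.continuousAt hs)
  unfold secular
  refine Tendsto.add_atTop (hc.tendsto.mono_left nhdsWithin_le_nhds) ?_
  have hall : ∀ᶠ θ in 𝓝[>] θ₀, ∀ i : Fin k, C i ≤ n i *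
      (Real.cos ((i.val + 2 : ℕ) * θ) / Real.sin ((i.val + 2 : ℕ) * θ)) :=
    eventually_all.2 hC
  refine tendsto_atTop_mono' _ ?_
    (tendsto_atTop_add_const_right _ (∑ i ∈ Finset.univ.erase i₀, C i) hmain)
  filter_upwards [hall] with θ hθ
  rw [← Finset.add_sum_erase _ _ (Finset.mem_univ i₀)]
  gcongr with i _
  exact hθ i

-- `secular` is odd, so this is the right-hand limit at `-θ₀` reflected.
open Filter Topology in
lemma tendsto_secular_left {θ₀ : ℝ} (hs : Real.sin θ₀ ≠ 0) (hp : IsPole n θ₀) :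
    Tendsto (secular n) (𝓝[<] θ₀) atBot := by
  have h := tendsto_secular_right n (θ₀ := -θ₀) (by simpa using hs) ((isPole_neg n).2 hp)
  have hneg : Tendsto (fun θ : ℝ => -θ) (𝓝[<] θ₀) (𝓝[>] (-θ₀)) := tendsto_neg_nhdsLT
  have h2 := tendsto_neg_atTop_atBot.comp (h.comp hneg)
  refine h2.congr fun θ => ?_
  simp [secular_neg]

lemma finite_poles : {θ | IsPole n θ ∧ 0 < θ ∧ θ < Real.pi}.Finite := by
  have : {θ | IsPole n θ ∧ 0 < θ ∧ θ < Real.pi} ⊆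
      ⋃ i : Fin k, (fun j : ℕ => j * Real.pi / (i.val + 2 : ℕ)) '' (Set.Iio (i.val + 2)) := by
    rintro θ ⟨⟨i, -, hi⟩, h0, h1⟩
    obtain ⟨z, hz⟩ := Real.sin_eq_zero_iff.1 hi
    have hpos : (0 : ℝ) < (i.val + 2 : ℕ) := by positivity
    have hz0 : 0 < z := by
      have : (0 : ℝ) < z * Real.pi := by rw [hz]; positivity
      exact_mod_cast pos_of_mul_pos_left this Real.pi_pos.le
    lift z to ℕ using hz0.le
    refine Set.mem_iUnion.2 ⟨i, z, ?_, ?_⟩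
    · have : (z : ℝ) * Real.pi < (i.val + 2 : ℕ) * Real.pi := by
        rw [show (z : ℝ) * Real.pi = (i.val + 2 : ℕ) * θ by exact_mod_cast hz]
        gcongr
      exact_mod_cast lt_of_mul_lt_mul_right this Real.pi_pos.le
    · simp only
      rw [div_eq_iff hpos.ne', mul_comm θ]
      exact_mod_cast hz
  exact (Set.finite_iUnion fun i => (Set.finite_Iio _).image _).subset this

-- All cotangents in the sum carry nonnegative weights, so every pole has `+∞` on its right and `-∞`
-- on its left; the intermediate value theorem applies between neighbouring poles.
open Filter Topology in
theorem exists_secular_zero {p q : ℝ} (hp : IsPole n p) (hq : IsPole n q) (h0 : 0 < p)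
    (hpq : p < q) (h1 : q < Real.pi) : ∃ θ, p < θ ∧ θ < q ∧ ¬ IsPole n θ ∧ secular n θ = 0 := by
  have hfin : {θ | IsPole n θ ∧ p < θ ∧ θ ≤ q}.Finite :=
    (finite_poles n).subset fun θ h => ⟨h.1, h0.trans h.2.1, h.2.2.trans_lt h1⟩
  -- `r` is the first pole after `p`, so that `secular` is continuous on `(p, r)`.
  obtain ⟨r, ⟨hr, hpr, hrq⟩, hmin⟩ := Set.exists_min_image _ id hfin ⟨q, hq, hpq, le_rfl⟩
  have hfree : ∀ θ, p < θ → θ < r → ¬ IsPole n θ := fun θ h2 h3 h4 =>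
    absurd (hmin θ ⟨h4, h2, (h3.trans_le hrq).le⟩) (not_le.2 h3)
  have hsin : ∀ θ, p ≤ θ → θ ≤ r → Real.sin θ ≠ 0 := fun θ h2 h3 =>
    (Real.sin_pos_of_pos_of_lt_pi (h0.trans_le h2) (h3.trans_lt (hrq.trans_lt h1))).ne'
  set c := (p + r) / 2 with hc
  obtain ⟨u, hu, hpu, huc⟩ := (((tendsto_secular_right n (hsin p le_rfl hpr.le) hp).eventually_gt_atTop
    0).and (Ioo_mem_nhdsGT (show p < c by linarith))).exists
  obtain ⟨v, hv, hcv, hvr⟩ := (((tendsto_secular_left n (hsin r hpr.le le_rfl) hr).eventually_lt_atBot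
    0).and (Ioo_mem_nhdsLT (show c < r by linarith))).exists
  have hcont : ContinuousOn (secular n) (Set.Icc u v) := fun θ hθ =>
    (continuousAt_secular n (hsin θ (hpu.le.trans hθ.1) (hθ.2.trans hvr.le))
      (hfree θ (hpu.trans_le hθ.1) (hθ.2.trans_lt hvr))).continuousWithinAt
  obtain ⟨θ, hθ, hz⟩ := intermediate_value_Icc' (huc.trans hcv).le hcont ⟨hv.le, hu.le⟩
  have h2 := hpu.trans_le hθ.1
  have h3 := hθ.2.trans_lt hvr
  exact ⟨θ, h2, h3.trans_le hrq, hfree θ h2 h3, hz⟩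

variable [DecidableRel (starlikeTree n).Adj]

lemma aeval_starlike_cos {θ : ℝ} (h0 : 0 < θ) (h1 : θ < Real.pi) (hp : ¬ IsPole n θ) :
    aeval (2 * Real.cos θ) (graphCharpoly (starlikeTree n)) =
      (∏ i : Fin k, pathVal (2 * Real.cos θ) (i.val + 2) ^ n i) * (Real.sin θ * secular n θ) := by
  have hs := Real.sin_pos_of_pos_of_lt_pi h0 h1
  have hne : ∀ i, 0 < n i → Real.sin ((i.val + 2 : ℕ) * θ) ≠ 0 := fun i hi h => hp ⟨i, hi, h⟩
  rw [aeval_starlike]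
  · congr 1
    unfold secular
    -- This is `sin ((m-1)θ) / sin (mθ) = cos θ - sin θ · cot (mθ)` with `m = i + 2`.
    have : ∀ i : Fin k, n i * (pathVal (2 * Real.cos θ) (i.val + 1) /
        pathVal (2 * Real.cos θ) (i.val + 2)) = n i * Real.cos θ - Real.sin θ * (n i *
        (Real.cos ((i.val + 2 : ℕ) * θ) / Real.sin ((i.val + 2 : ℕ) * θ))) := by
      intro i
      rcases Nat.eq_zero_or_pos (n i) with h | h
      · simp [h]
      · have h2 := hne i h
        rw [← mul_div_mul_right (pathVal (2 * Real.cos θ) (i.val + 1)) _ hs.ne',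
          pathVal_two_mul_cos, pathVal_two_mul_cos,
          show ((i.val + 1 : ℕ) : ℝ) * θ = (i.val + 2 : ℕ) * θ - θ by push_cast; ring,
          Real.sin_sub]
        field_simp
    rw [Finset.sum_congr rfl fun i _ => this i, Finset.sum_sub_distrib, ← Finset.sum_mul,
      ← Finset.mul_sum]
    generalize ∑ i : Fin k, (n i : ℝ) * (Real.cos ((i.val + 2 : ℕ) * θ) /
      Real.sin ((i.val + 2 : ℕ) * θ)) = S
    field_simp
    ring
  · intro i hi h
    apply hne i hi
    rw [← pathVal_two_mul_cos, h, zero_mul]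

end Secular

/-! ### The largest eigenvalue and the eigenvalues below it -/

lemma exists_root_gt {p : ℤ[X]} (hp : p.Monic) {x : ℝ} (hx : aeval x p < 0) :
    ∃ r, x < r ∧ aeval r p = 0 := by
  set q : ℝ[X] := p.map (Int.castRingHom ℝ) with hq
  have hqm : q.Monic := hp.map _
  have heval : ∀ y, aeval y p = q.eval y := fun y => by
    rw [hq, eval_map, ← algebraMap_int_eq, aeval_def]
  simp only [heval] at hx ⊢
  have hdeg : 0 < q.degree := by
    by_contra h
    rw [hqm.degree_le_zero_iff_eq_one.1 (not_lt.1 h)] at hx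
    simp only [eval_one] at hx
    linarith
  have htop := q.tendsto_atTop_of_leadingCoeff_nonneg hdeg (by rw [hqm.leadingCoeff]; exact zero_le_one)
  obtain ⟨y, hy, hxy⟩ := ((htop.eventually_gt_atTop 0).and (Filter.eventually_gt_atTop x)).exists
  obtain ⟨r, hr, h0⟩ := intermediate_value_Icc hxy.le q.continuous.continuousOn ⟨hx.le, hy.le⟩
  refine ⟨r, lt_of_le_of_ne hr.1 ?_, h0⟩
  rintro rfl
  exact hx.ne h0

lemma pathVal_pos {x : ℝ} {m : ℕ} (hm : 0 < m) (hx : 2 * Real.cos (Real.pi / m) < x) :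
    0 < pathVal x m := by
  obtain ⟨d, rfl⟩ : ∃ d, m = d + 1 := ⟨m - 1, by omega⟩
  rcases le_or_gt 2 x with h2 | h2
  · exact pathVal_pos_of_two_le h2 d
  · have hm1 : Real.pi / (d + 1 : ℕ) ≤ Real.pi :=
      div_le_self Real.pi_pos.le (by exact_mod_cast hm)
    have hc := Real.neg_one_le_cos (Real.pi / (d + 1 : ℕ))
    have hcos : Real.cos (Real.arccos (x / 2)) = x / 2 :=
      Real.cos_arccos (by linarith) (by linarith)
    set θ := Real.arccos (x / 2) with hθ
    have h0 : 0 < θ := Real.arccos_pos.2 (by linarith)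
    have h1 : θ < Real.pi / (d + 1 : ℕ) := by
      by_contra h
      have := Real.cos_le_cos_of_nonneg_of_le_pi (by positivity) (Real.arccos_le_pi _) (not_lt.1 h)
      rw [← hθ, hcos] at this
      linarith
    have hs := Real.sin_pos_of_pos_of_lt_pi h0 (h1.trans_le hm1)
    have hs' : 0 < Real.sin ((d + 1 : ℕ) * θ) := by
      apply Real.sin_pos_of_pos_of_lt_pi (by positivity)
      rw [lt_div_iff₀ (by positivity)] at h1
      linarith
    rw [← pathVal_two_mul_cos, hcos] at hs'
    have := pos_of_mul_pos_left hs' hs.le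
    rwa [mul_div_cancel₀ x two_ne_zero] at this

section

variable {k : ℕ} {n : Fin k → ℕ}

lemma isPole_div {i : Fin k} (hi : 0 < n i) (j : ℕ) : IsPole n (Real.pi * (j / (i.val + 2 : ℕ))) := by
  refine ⟨i, hi, Real.sin_eq_zero_iff.2 ⟨j, ?_⟩⟩
  have : ((i.val + 2 : ℕ) : ℝ) ≠ 0 := by positivity
  field_simp
  simp

/-- `2 cos (π t)` is an eigenvalue of the starlike tree, but not of any of its branches. -/
def IsNewAngle (n : Fin k → ℕ) (t : ℝ) : Prop := ¬ IsPole n (Real.pi * t) ∧ secular n (Real.pi * t) = 0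

lemma exists_newAngle {i i' : Fin k} (hi : 0 < n i) (hi' : 0 < n i') {j j' : ℕ} (hj : 0 < j)
    (hlt : (j : ℝ) / (i.val + 2 : ℕ) < j' / (i'.val + 2 : ℕ))
    (hle : (j' : ℝ) / (i'.val + 2 : ℕ) ≤ 1 / 2) :
    ∃ t, (j : ℝ) / (i.val + 2 : ℕ) < t ∧ t < j' / (i'.val + 2 : ℕ) ∧ IsNewAngle n t := by
  obtain ⟨θ, h1, h2, h3, h4⟩ := exists_secular_zero n (isPole_div hi j) (isPole_div hi' j')
    (by positivity) (by gcongr) (by nlinarith [Real.pi_pos])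
  have hθ : Real.pi * (θ / Real.pi) = θ := by field_simp
  refine ⟨θ / Real.pi, ?_, ?_, by unfold IsNewAngle; rw [hθ]; exact ⟨h3, h4⟩⟩
  · rw [lt_div_iff₀ Real.pi_pos]; linarith
  · rw [div_lt_iff₀ Real.pi_pos]; linarith

variable [DecidableRel (starlikeTree n).Adj]

-- Take the longest branch. Just left of its first pole `secular` is negative while all path values
-- are positive, so `f_T` is negative at a point beyond every branch eigenvalue and has a root
-- further right.
open Filter Topology in
theorem branch_lt_greatest {ρ : ℝ} (hρ : IsGreatest (graphEigenvalues (starlikeTree n)) ρ)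
    {i : Fin k} (hi : 0 < n i) : 2 * Real.cos (Real.pi / (i.val + 2 : ℕ)) < ρ := by
  obtain ⟨m, hm, hmax⟩ := Finset.exists_max_image (Finset.univ.filter fun i => 0 < n i)
    (fun i => i.val) ⟨i, by simpa using hi⟩
  simp only [Finset.mem_filter, Finset.mem_univ, true_and] at hm hmax
  have hle : ∀ i, 0 < n i → Real.pi / (m.val + 2 : ℕ) ≤ Real.pi / (i.val + 2 : ℕ) := by
    intro i hi
    have := hmax i hi
    gcongr
  have hpi : ∀ i : Fin k, Real.pi / (i.val + 2 : ℕ) < Real.pi := fun i =>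
    div_lt_self Real.pi_pos (by push_cast; linarith [(Nat.cast_nonneg i.val : (0 : ℝ) ≤ i.val)])
  have hmpos : 0 < Real.pi / (m.val + 2 : ℕ) := by positivity
  have hpole : IsPole n (Real.pi / (m.val + 2 : ℕ)) := by
    have := isPole_div hm 1
    rwa [Nat.cast_one, ← mul_div_assoc, mul_one] at this
  obtain ⟨θ, hneg, h0, h1⟩ := (((tendsto_secular_left n
    (Real.sin_pos_of_pos_of_lt_pi hmpos (hpi m)).ne' hpole).eventually_lt_atBot 0).and
    (Ioo_mem_nhdsLT hmpos)).exists
  have hs := Real.sin_pos_of_pos_of_lt_pi h0 (h1.trans (hpi m))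
  have hsin : ∀ i : Fin k, 0 < n i → 0 < Real.sin ((i.val + 2 : ℕ) * θ) := by
    intro i hi
    apply Real.sin_pos_of_pos_of_lt_pi (by positivity)
    have h2 := h1.trans_le (hle i hi)
    rw [lt_div_iff₀ (by positivity)] at h2
    linarith
  have hnp : ¬ IsPole n θ := fun ⟨i, hi, h⟩ => (hsin i hi).ne' h
  have hval : aeval (2 * Real.cos θ) (graphCharpoly (starlikeTree n)) < 0 := by
    rw [aeval_starlike_cos n h0 (h1.trans (hpi m)) hnp]
    refine mul_neg_of_pos_of_neg (Finset.prod_pos fun i _ => ?_) (mul_neg_of_pos_of_neg hs hneg)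
    rcases Nat.eq_zero_or_pos (n i) with h | h
    · simp [h]
    · have h3 := hsin i h
      rw [← pathVal_two_mul_cos] at h3
      exact pow_pos (pos_of_mul_pos_left h3 hs.le) _
  obtain ⟨r, hr, hr0⟩ := exists_root_gt (monic_graphCharpoly _) hval
  have h4 : r ≤ ρ := hρ.2 hr0
  have h5 := Real.cos_lt_cos_of_nonneg_of_le_pi h0.le (hpi i).le (h1.trans_le (hle i hi))
  linarith

lemma greatest_eq_sum {ρ : ℝ} (hρ : IsGreatest (graphEigenvalues (starlikeTree n)) ρ) :
    (∀ i, 0 < n i → 0 < pathVal ρ (i.val + 2)) ∧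
    ρ = ∑ i : Fin k, n i * (pathVal ρ (i.val + 1) / pathVal ρ (i.val + 2)) := by
  have hpos : ∀ i, 0 < n i → 0 < pathVal ρ (i.val + 2) := fun i hi =>
    pathVal_pos (by omega) (branch_lt_greatest hρ hi)
  refine ⟨hpos, ?_⟩
  have h0 : aeval ρ (graphCharpoly (starlikeTree n)) = 0 := hρ.1
  rw [aeval_starlike n fun i hi => (hpos i hi).ne'] at h0
  rcases mul_eq_zero.1 h0 with h | h
  · refine absurd h (Finset.prod_pos fun i _ => ?_).ne'
    rcases Nat.eq_zero_or_pos (n i) with h | h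
    · simp [h]
    · exact pow_pos (hpos i h) _
  · linarith

lemma IsNewAngle.aeval_eq_zero {t : ℝ} (h : IsNewAngle n t) (h0 : 0 < t) (h1 : t < 1) :
    aeval (2 * Real.cos (Real.pi * t)) (graphCharpoly (starlikeTree n)) = 0 := by
  rw [aeval_starlike_cos n (by positivity) (by nlinarith [Real.pi_pos]) h.1, h.2]
  simp

lemma IsNewAngle.eq_sum {t : ℝ} (h : IsNewAngle n t) (h0 : 0 < t) (h1 : t < 1) {x : ℝ}
    (hx : x = 2 * Real.cos (Real.pi * t)) :
    (∀ i, 0 < n i → pathVal x (i.val + 2) ≠ 0) ∧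
    x = ∑ i : Fin k, n i * (pathVal x (i.val + 1) / pathVal x (i.val + 2)) := by
  have hpos : ∀ i, 0 < n i → pathVal x (i.val + 2) ≠ 0 := fun i hi h' =>
    h.1 ⟨i, hi, by rw [← pathVal_two_mul_cos, ← hx, h', zero_mul]⟩
  refine ⟨hpos, ?_⟩
  have h2 := h.aeval_eq_zero h0 h1
  rw [← hx, aeval_starlike n hpos] at h2
  rcases mul_eq_zero.1 h2 with h3 | h3
  · obtain ⟨i, -, hi⟩ := Finset.prod_eq_zero_iff.1 h3
    rcases Nat.eq_zero_or_pos (n i) with h | h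
    · simp [h] at hi
    · exact absurd hi (pow_ne_zero _ (hpos i h))
  · linarith

end

/-! ### Angles of the admissible eigenvalues -/

lemma two_mul_cos_sq_injOn {s t : ℝ} (hs : 0 < s) (hs' : s < 1 / 2) (ht : 0 < t) (ht' : t < 1 / 2)
    (h : (2 * Real.cos (Real.pi * s)) ^ 2 = (2 * Real.cos (Real.pi * t)) ^ 2) : s = t := by
  have hpi := Real.pi_pos
  have h1 : 0 < Real.cos (Real.pi * s) := Real.cos_pos_of_mem_Ioo ⟨by nlinarith, by nlinarith⟩
  have h2 : 0 < Real.cos (Real.pi * t) := Real.cos_pos_of_mem_Ioo ⟨by nlinarith, by nlinarith⟩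
  have h3 : Real.cos (Real.pi * s) = Real.cos (Real.pi * t) := by
    have := (pow_left_inj₀ (by positivity) (by positivity) two_ne_zero).1 h
    linarith
  have := Real.injOn_cos ⟨by positivity, by nlinarith⟩ ⟨by positivity, by nlinarith⟩ h3
  exact mul_left_cancel₀ hpi.ne' this

lemma two_mul_cos_third : 2 * Real.cos (Real.pi * (1 / 3)) = 1 := by
  rw [mul_one_div, Real.cos_pi_div_three]; norm_num

lemma two_mul_cos_fourth : 2 * Real.cos (Real.pi * (1 / 4)) = √2 := by
  rw [mul_one_div, Real.cos_pi_div_four]; ring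

lemma two_mul_cos_sixth : 2 * Real.cos (Real.pi * (1 / 6)) = √3 := by
  rw [mul_one_div, Real.cos_pi_div_six]; ring

lemma two_mul_cos_fifth : 2 * Real.cos (Real.pi * (1 / 5)) = (1 + √5) / 2 := by
  rw [mul_one_div, Real.cos_pi_div_five]; ring

lemma two_mul_cos_two_fifths : 2 * Real.cos (Real.pi * (2 / 5)) = (√5 - 1) / 2 := by
  have h5 : √5 ^ 2 = 5 := Real.sq_sqrt (by norm_num)
  rw [show Real.pi * (2 / 5) = 2 * (Real.pi / 5) by ring, Real.cos_two_mul, Real.cos_pi_div_five]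
  nlinarith

/-- The angles `t` for which `2 cos (π t)` is a positive integer or quadratic irrational. -/
def IsSpecialAngle (t : ℝ) : Prop := t = 1 / 3 ∨ t = 1 / 4 ∨ t = 1 / 5 ∨ t = 2 / 5 ∨ t = 1 / 6

/-- The five simple factors produce the special angles. The roots of the last two quadratics are
`±ρ` and `±(a - ρ)`; positivity and the bound by `ρ` leave only `|a - ρ|`. -/
lemma isSpecialAngle_or {f : ℤ[X]} {a b : ℤ} {t₁ t₂ t₃ t₄ t₅ : ℕ} (hf : f = X ^ t₁ * (X ^ 2 - 1) ^ t₂ *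
      (X ^ 2 - 2) ^ t₃ * ((X ^ 2 - X - 1) * (X ^ 2 + X - 1)) ^ t₄ * (X ^ 2 - 3) ^ t₅
        * ((X ^ 2 - C a * X + C b) * (X ^ 2 + C a * X + C b))) {ρ : ℝ}
    (hρ : ρ ^ 2 - (a : ℝ) * ρ + (b : ℝ) = 0) {t : ℝ} (h0 : 0 < t) (h1 : t < 1 / 2)
    (ht : aeval (2 * Real.cos (Real.pi * t)) f = 0) (hlt : 2 * Real.cos (Real.pi * t) < ρ) :
    IsSpecialAngle t ∨ 2 * Real.cos (Real.pi * t) = |a - ρ| := by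
  have hpi := Real.pi_pos
  have h5 : √5 ^ 2 = 5 := Real.sq_sqrt (by norm_num)
  have hx : 0 < 2 * Real.cos (Real.pi * t) :=
    mul_pos two_pos (Real.cos_pos_of_mem_Ioo ⟨by nlinarith, by nlinarith⟩)
  have hinj : ∀ s, 0 < s → s < 1 / 2 →
      (2 * Real.cos (Real.pi * t)) ^ 2 = (2 * Real.cos (Real.pi * s)) ^ 2 → t = s :=
    fun s hs hs' h => two_mul_cos_sq_injOn h0 h1 hs hs' h
  generalize 2 * Real.cos (Real.pi * t) = x at *
  rw [hf] at ht
  simp only [map_mul, map_pow, map_sub, map_add, aeval_X, map_one, map_ofNat, eq_intCast,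
    map_intCast, mul_eq_zero] at ht
  rcases ht with ((((h | h) | h) | h) | h) | h | h
  · exact absurd (eq_zero_of_pow_eq_zero h) hx.ne'
  · refine Or.inl (Or.inl (hinj _ (by norm_num) (by norm_num) ?_))
    rw [two_mul_cos_third]
    linarith [eq_zero_of_pow_eq_zero h]
  · refine Or.inl (Or.inr (Or.inl (hinj _ (by norm_num) (by norm_num) ?_)))
    rw [two_mul_cos_fourth, Real.sq_sqrt (by norm_num)]
    linarith [eq_zero_of_pow_eq_zero h]
  · have h' := eq_zero_of_pow_eq_zero h
    -- As a quadratic in `x²`, the golden factor is `y² - 3y + 1`, with roots `(3 ± √5)/2`.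
    have : (x ^ 2 - ((1 + √5) / 2) ^ 2) * (x ^ 2 - ((√5 - 1) / 2) ^ 2) = 0 := by
      have e1 : ((1 + √5) / 2) ^ 2 = (3 + √5) / 2 := by nlinarith
      have e2 : ((√5 - 1) / 2) ^ 2 = (3 - √5) / 2 := by nlinarith
      rw [e1, e2]
      nlinarith
    rcases mul_eq_zero.1 this with h | h
    · refine Or.inl (Or.inr (Or.inr (Or.inl (hinj _ (by norm_num) (by norm_num) ?_))))
      rw [two_mul_cos_fifth]
      linarith
    · refine Or.inl (Or.inr (Or.inr (Or.inr (Or.inl (hinj _ (by norm_num) (by norm_num) ?_)))))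
      rw [two_mul_cos_two_fifths]
      linarith
  · refine Or.inl (Or.inr (Or.inr (Or.inr (Or.inr (hinj _ (by norm_num) (by norm_num) ?_)))))
    rw [two_mul_cos_sixth, Real.sq_sqrt (by norm_num)]
    linarith [eq_zero_of_pow_eq_zero h]
  · right
    have : (x - ρ) * (x - (a - ρ)) = 0 := by linear_combination h - hρ
    rcases mul_eq_zero.1 this with h | h
    · linarith
    · rw [abs_of_pos] <;> linarith
  · right
    have : (x + ρ) * (x + (a - ρ)) = 0 := by linear_combination h - hρ
    rcases mul_eq_zero.1 this with h | h
    · linarith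
    · rw [abs_of_neg] <;> linarith

/-! ### Restrictions imposed by a new eigenvalue at a special angle -/

lemma pathVal_add_of_eq_zero {x : ℝ} {p : ℕ} (h : pathVal x p = 0) (m : ℕ) :
    pathVal x (p + m) = pathVal x (p + 1) * pathVal x m := by
  induction m using Nat.twoStepInduction with
  | zero => simp [h]
  | one => simp
  | more m ih1 ih2 =>
    rw [← add_assoc, pathVal_add_two, add_assoc, ih1, ih2, pathVal_add_two]
    ring

/-- At a zero of `pathVal x p` the path values repeat with period `p` up to a constant factor, so
the ratios in the secular equation are genuinely periodic and only finitely many need computing. -/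
lemma branchRatio_add {x : ℝ} {p : ℕ} (h : pathVal x p = 0) (h1 : pathVal x (p + 1) ≠ 0) (m : ℕ) :
    pathVal x (p + m + 1) / pathVal x (p + m + 2) = pathVal x (m + 1) / pathVal x (m + 2) := by
  rw [add_assoc, add_assoc, pathVal_add_of_eq_zero h (m + 1), pathVal_add_of_eq_zero h (m + 2),
    mul_div_mul_left _ _ h1]

lemma sum_fin_twelve (n : Fin 12 → ℕ) (r : ℕ → ℝ) :
    ∑ i : Fin 12, (n i : ℝ) * r i.val = n 0 * r 0 + n 1 * r 1 + n 2 * r 2 + n 3 * r 3 + n 4 * r 4 +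
      n 5 * r 5 + n 6 * r 6 + n 7 * r 7 + n 8 * r 8 + n 9 * r 9 + n 10 * r 10 + n 11 * r 11 := by
  simp [Fin.sum_univ_succ]
  ring

lemma int_sqrt_five {p q : ℤ} (h : (p : ℝ) * √5 + q = 0) : p = 0 ∧ q = 0 := by
  have h5 : Irrational √5 := by
    have := Nat.Prime.irrational_sqrt (p := 5) (by norm_num)
    exact_mod_cast this
  have hp : p = 0 := by
    by_contra hp
    refine h5 ⟨-q / p, ?_⟩
    have : (p : ℝ) ≠ 0 := by exact_mod_cast hp
    push_cast
    field_simp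
    linarith
  subst hp
  simpa using h

section Equations

variable {n : Fin 12 → ℕ}

lemma IsNewAngle.third_eq (h : IsNewAngle n (1 / 3)) :
    n 1 = 0 ∧ n 4 = 0 ∧ n 7 = 0 ∧ n 10 = 0 ∧ n 0 + n 3 + n 6 + n 9 = 1 := by
  classical
  obtain ⟨hne, hsum⟩ := h.eq_sum (by norm_num) (by norm_num) two_mul_cos_third.symm
  have u2 : pathVal 1 2 = 1 := by simp [pathVal_add_two 1 0]
  have u3 : pathVal 1 3 = 0 := by simp [pathVal_add_two 1 1, u2]
  have u4 : pathVal 1 (3 + 1) ≠ 0 := by simp [pathVal_add_two 1 2, u2, u3]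
  have per := branchRatio_add u3 u4
  have z : ∀ m, pathVal 1 m = 0 → pathVal 1 (3 + m) = 0 := fun m hm => by
    rw [pathVal_add_of_eq_zero u3, hm, mul_zero]
  rw [sum_fin_twelve n (fun i => pathVal 1 (i + 1) / pathVal 1 (i + 2))] at hsum
  have r0 : pathVal 1 (0 + 1) / pathVal 1 (0 + 2) = 1 := by simp [u2]
  -- Here the denominator is zero and the quotient defaults to `0`. The corresponding multiplicities
  -- vanish anyway, by `hne`.
  have r1 : pathVal 1 (1 + 1) / pathVal 1 (1 + 2) = 0 := by simp [u3]
  have r2 : pathVal 1 (2 + 1) / pathVal 1 (2 + 2) = 0 := by simp [u3]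
  have r3 := (per 0).trans r0
  have r4 := (per 1).trans r1
  have r5 := (per 2).trans r2
  have r6 := (per 3).trans r3
  have r7 := (per 4).trans r4
  have r8 := (per 5).trans r5
  have r9 := (per 6).trans r6
  have r10 := (per 7).trans r7
  have r11 := (per 8).trans r8
  norm_num only [Nat.reduceAdd] at r0 r1 r2 r3 r4 r5 r6 r7 r8 r9 r10 r11 hsum
  rw [r0, r1, r2, r3, r4, r5, r6, r7, r8, r9, r10, r11] at hsum
  refine ⟨?_, ?_, ?_, ?_, ?_⟩
  · by_contra h0; exact hne 1 (Nat.pos_of_ne_zero h0) u3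
  · by_contra h0; exact hne 4 (Nat.pos_of_ne_zero h0) (z 3 u3)
  · by_contra h0; exact hne 7 (Nat.pos_of_ne_zero h0) (z 6 (z 3 u3))
  · by_contra h0; exact hne 10 (Nat.pos_of_ne_zero h0) (z 9 (z 6 (z 3 u3)))
  · have : (1 : ℝ) = n 0 + n 3 + n 6 + n 9 := by linarith
    exact_mod_cast this.symm

lemma IsNewAngle.fourth_eq (h : IsNewAngle n (1 / 4)) :
    n 2 = 0 ∧ n 6 = 0 ∧ n 10 = 0 ∧ n 0 + n 4 + n 8 + 2 * (n 1 + n 5 + n 9) = 2 := by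
  classical
  obtain ⟨hne, hsum⟩ := h.eq_sum (by norm_num) (by norm_num) two_mul_cos_fourth.symm
  have hx0 : √2 ≠ 0 := by positivity
  have hx : √2 ^ 2 = 2 := Real.sq_sqrt (by norm_num)
  generalize √2 = x at *
  have u2 : pathVal x 2 = x := by simp [pathVal_add_two x 0]
  have u3 : pathVal x 3 = 1 := by rw [pathVal_add_two x 1, u2, pathVal_one]; linarith
  have u4 : pathVal x 4 = 0 := by rw [pathVal_add_two x 2, u2, u3]; ring
  have u5 : pathVal x (4 + 1) ≠ 0 := by simp [pathVal_add_two x 3, u4, u3]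
  have per := branchRatio_add u4 u5
  have z : ∀ m, pathVal x m = 0 → pathVal x (4 + m) = 0 := fun m hm => by
    rw [pathVal_add_of_eq_zero u4, hm, mul_zero]
  rw [sum_fin_twelve n (fun i => pathVal x (i + 1) / pathVal x (i + 2))] at hsum
  have r0 : pathVal x (0 + 1) / pathVal x (0 + 2) = x / 2 := by
    simp only [zero_add, u2, pathVal_one]; field_simp; linarith
  have r1 : pathVal x (1 + 1) / pathVal x (1 + 2) = x := by simp [u2, u3]
  have r2 : pathVal x (2 + 1) / pathVal x (2 + 2) = 0 := by simp [u4]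
  have r3 : pathVal x (3 + 1) / pathVal x (3 + 2) = 0 := by simp [u4]
  have r4 := (per 0).trans r0
  have r5 := (per 1).trans r1
  have r6 := (per 2).trans r2
  have r7 := (per 3).trans r3
  have r8 := (per 4).trans r4
  have r9 := (per 5).trans r5
  have r10 := (per 6).trans r6
  have r11 := (per 7).trans r7
  norm_num only [Nat.reduceAdd] at r0 r1 r2 r3 r4 r5 r6 r7 r8 r9 r10 r11 hsum
  rw [r0, r1, r2, r3, r4, r5, r6, r7, r8, r9, r10, r11] at hsum
  refine ⟨?_, ?_, ?_, ?_⟩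
  · by_contra h0; exact hne 2 (Nat.pos_of_ne_zero h0) u4
  · by_contra h0; exact hne 6 (Nat.pos_of_ne_zero h0) (z 4 u4)
  · by_contra h0; exact hne 10 (Nat.pos_of_ne_zero h0) (z 8 (z 4 u4))
  · have : x * (n 0 + n 4 + n 8 + 2 * (n 1 + n 5 + n 9)) = x * 2 := by linarith
    exact_mod_cast mul_left_cancel₀ hx0 this

lemma IsNewAngle.sixth_eq (h : IsNewAngle n (1 / 6)) :
    n 4 = 0 ∧ n 10 = 0 ∧
      2 * (n 0 + n 6) + 3 * (n 1 + n 7) + 4 * (n 2 + n 8) + 6 * (n 3 + n 9) = 6 := by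
  classical
  obtain ⟨hne, hsum⟩ := h.eq_sum (by norm_num) (by norm_num) two_mul_cos_sixth.symm
  have hx0 : √3 ≠ 0 := by positivity
  have hx : √3 ^ 2 = 3 := Real.sq_sqrt (by norm_num)
  generalize √3 = x at *
  have u2 : pathVal x 2 = x := by simp [pathVal_add_two x 0]
  have u3 : pathVal x 3 = 2 := by rw [pathVal_add_two x 1, u2, pathVal_one]; linarith
  have u4 : pathVal x 4 = x := by rw [pathVal_add_two x 2, u2, u3]; ring
  have u5 : pathVal x 5 = 1 := by rw [pathVal_add_two x 3, u3, u4]; linarith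
  have u6 : pathVal x 6 = 0 := by rw [pathVal_add_two x 4, u4, u5]; ring
  have u7 : pathVal x (6 + 1) ≠ 0 := by simp [pathVal_add_two x 5, u5, u6]
  have per := branchRatio_add u6 u7
  rw [sum_fin_twelve n (fun i => pathVal x (i + 1) / pathVal x (i + 2))] at hsum
  have r0 : pathVal x (0 + 1) / pathVal x (0 + 2) = x / 3 := by
    simp only [zero_add, u2, pathVal_one]; field_simp; linarith
  have r1 : pathVal x (1 + 1) / pathVal x (1 + 2) = x / 2 := by simp [u2, u3]
  have r2 : pathVal x (2 + 1) / pathVal x (2 + 2) = 2 * x / 3 := by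
    simp only [Nat.reduceAdd, u3, u4]; field_simp; linarith
  have r3 : pathVal x (3 + 1) / pathVal x (3 + 2) = x := by simp [u4, u5]
  have r4 : pathVal x (4 + 1) / pathVal x (4 + 2) = 0 := by simp [u6]
  have r5 : pathVal x (5 + 1) / pathVal x (5 + 2) = 0 := by simp [u6]
  have r6 := (per 0).trans r0
  have r7 := (per 1).trans r1
  have r8 := (per 2).trans r2
  have r9 := (per 3).trans r3
  have r10 := (per 4).trans r4
  have r11 := (per 5).trans r5
  norm_num only [Nat.reduceAdd] at r0 r1 r2 r3 r4 r5 r6 r7 r8 r9 r10 r11 hsum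
  rw [r0, r1, r2, r3, r4, r5, r6, r7, r8, r9, r10, r11] at hsum
  refine ⟨?_, ?_, ?_⟩
  · by_contra h0; exact hne 4 (Nat.pos_of_ne_zero h0) u6
  · by_contra h0
    exact hne 10 (Nat.pos_of_ne_zero h0) (by
      change pathVal x (6 + 6) = 0
      rw [pathVal_add_of_eq_zero u6, u6, mul_zero])
  · have : x * (2 * (n 0 + n 6) + 3 * (n 1 + n 7) + 4 * (n 2 + n 8) + 6 * (n 3 + n 9)) = x * 6 := by
      linarith
    exact_mod_cast mul_left_cancel₀ hx0 this

/-- The golden ratio (`ε = 1`) and its inverse (`ε = -1`) are treated together. All ratios lie in `ℤ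
+ ℤx`, so irrationality of `√5` splits the secular equation into two integer equations, which do not
depend on `ε`. -/
lemma golden_eq {x : ℝ} {e : ℤ} {ε : ℝ} (he : e = ε) (hε : ε ^ 2 = 1) (hx : x ^ 2 = 1 + ε * x) (hx5 : x = (√5 + ε) / 2)
    (hne : ∀ i, 0 < n i → pathVal x (i.val + 2) ≠ 0)
    (hsum : x = ∑ i : Fin 12, n i * (pathVal x (i.val + 1) / pathVal x (i.val + 2))) :
    n 3 = 0 ∧ n 8 = 0 ∧ n 0 + n 5 + n 10 + (n 2 + n 7) = 1 ∧
      n 1 + n 6 + n 11 = n 0 + n 5 + n 10 := by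
  have hx0 : x ≠ 0 := by
    rintro rfl
    norm_num at hx
  have hε0 : ε ≠ 0 := by
    rintro rfl
    norm_num at hε
  have u2 : pathVal x 2 = x := by simp [pathVal_add_two x 0]
  have u3 : pathVal x 3 = ε * x := by rw [pathVal_add_two x 1, u2, pathVal_one]; linarith
  have u4 : pathVal x 4 = ε := by
    rw [pathVal_add_two x 2, u2, u3]; linear_combination ε * hx + x * hε
  have u5 : pathVal x 5 = 0 := by rw [pathVal_add_two x 3, u3, u4]; ring
  have u6 : pathVal x (5 + 1) ≠ 0 := by simpa [pathVal_add_two x 4, u5, u4] using hε0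
  have per := branchRatio_add u5 u6
  rw [sum_fin_twelve n (fun i => pathVal x (i + 1) / pathVal x (i + 2))] at hsum
  have r0 : pathVal x (0 + 1) / pathVal x (0 + 2) = x - ε := by
    simp only [zero_add, u2, pathVal_one]; field_simp; linarith
  have r1 : pathVal x (1 + 1) / pathVal x (1 + 2) = ε := by
    simp only [Nat.reduceAdd, u2, u3]; field_simp; linarith
  have r2 : pathVal x (2 + 1) / pathVal x (2 + 2) = x := by
    simp only [Nat.reduceAdd, u3, u4]; field_simp
  have r3 : pathVal x (3 + 1) / pathVal x (3 + 2) = 0 := by simp [u5]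
  have r4 : pathVal x (4 + 1) / pathVal x (4 + 2) = 0 := by simp [u5]
  have r5 := (per 0).trans r0
  have r6 := (per 1).trans r1
  have r7 := (per 2).trans r2
  have r8 := (per 3).trans r3
  have r9 := (per 4).trans r4
  have r10 := (per 5).trans r5
  have r11 := (per 6).trans r6
  norm_num only [Nat.reduceAdd] at r0 r1 r2 r3 r4 r5 r6 r7 r8 r9 r10 r11 hsum
  rw [r0, r1, r2, r3, r4, r5, r6, r7, r8, r9, r10, r11] at hsum
  have key : ((n 0 + n 5 + n 10 + (n 2 + n 7) - 1 : ℤ) : ℝ) * x +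
      ε * ((n 1 + n 6 + n 11 - (n 0 + n 5 + n 10) : ℤ) : ℝ) = 0 := by
    push_cast
    linarith
  obtain ⟨h6, h7⟩ := int_sqrt_five (p := n 0 + n 5 + n 10 + (n 2 + n 7) - 1)
    (q := e * ((n 0 + n 5 + n 10 + (n 2 + n 7) - 1) +
      2 * (n 1 + n 6 + n 11 - (n 0 + n 5 + n 10)))) (by
    rw [hx5] at key
    push_cast at key ⊢
    rw [he]
    linear_combination 2 * key)
  refine ⟨?_, ?_, ?_⟩
  · by_contra h0; exact hne 3 (Nat.pos_of_ne_zero h0) u5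
  · by_contra h0
    exact hne 8 (Nat.pos_of_ne_zero h0) (by
      change pathVal x (5 + 5) = 0
      rw [pathVal_add_of_eq_zero u5, u5, mul_zero])
  · rcases mul_eq_zero.1 h7 with h8 | h8
    · subst h8
      simp at he
      exact absurd he.symm hε0
    · omega

lemma IsNewAngle.fifth_eq (h : IsNewAngle n (1 / 5)) :
    n 3 = 0 ∧ n 8 = 0 ∧ n 0 + n 5 + n 10 + (n 2 + n 7) = 1 ∧
      n 1 + n 6 + n 11 = n 0 + n 5 + n 10 := by
  classical
  obtain ⟨hne, hsum⟩ := h.eq_sum (by norm_num) (by norm_num) two_mul_cos_fifth.symm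
  have h5 : √5 ^ 2 = 5 := Real.sq_sqrt (by norm_num)
  exact golden_eq (e := 1) (ε := 1) (by norm_num) (by norm_num) (by linear_combination h5 / 4) (by ring) hne hsum

lemma IsNewAngle.two_fifths_eq (h : IsNewAngle n (2 / 5)) :
    n 3 = 0 ∧ n 8 = 0 ∧ n 0 + n 5 + n 10 + (n 2 + n 7) = 1 ∧
      n 1 + n 6 + n 11 = n 0 + n 5 + n 10 := by
  classical
  obtain ⟨hne, hsum⟩ := h.eq_sum (by norm_num) (by norm_num) two_mul_cos_two_fifths.symm
  have h5 : √5 ^ 2 = 5 := Real.sq_sqrt (by norm_num)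
  exact golden_eq (e := -1) (ε := -1) (by norm_num) (by norm_num) (by linear_combination h5 / 4) (by ring) hne hsum

end Equations

/-! ### Branch lengths -/

/-- Between any two poles there is a new angle, which is special or equal to `τ`. -/
def HasGaps {k : ℕ} (n : Fin k → ℕ) (τ : ℝ) : Prop :=
  ∀ (i i' : Fin k) (j j' : ℕ), 0 < n i → 0 < n i' → 0 < j →
    (j : ℝ) / (i.val + 2 : ℕ) < j' / (i'.val + 2 : ℕ) → (j' : ℝ) / (i'.val + 2 : ℕ) ≤ 1 / 2 →
    ∃ t, (j : ℝ) / (i.val + 2 : ℕ) < t ∧ t < j' / (i'.val + 2 : ℕ) ∧ IsNewAngle n t ∧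
      (IsSpecialAngle t ∨ t = τ)

/-- Every eigenvalue `2 cos (π t)` in `(0, ρ)` comes from a special angle or from `τ`. -/
def EigenvaluesBelow (f : ℤ[X]) (ρ τ : ℝ) : Prop :=
  ∀ t, 0 < t → t < 1 / 2 → aeval (2 * Real.cos (Real.pi * t)) f = 0 →
    2 * Real.cos (Real.pi * t) < ρ → IsSpecialAngle t ∨ t = τ

/-- `τ` is the angle of `|a - ρ|`, unique by injectivity of the cosine. -/
lemma exists_eigenvaluesBelow {V : Type*} [Fintype V] [DecidableEq V] {T : SimpleGraph V}
    [DecidableRel T.Adj] {a b : ℤ} (h : HasFormII T a b) {ρ : ℝ}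
    (hρ : ρ ^ 2 - (a : ℝ) * ρ + (b : ℝ) = 0) : ∃ τ, EigenvaluesBelow (graphCharpoly T) ρ τ := by
  obtain ⟨-, -, -, -, t₁, t₂, t₃, t₄, t₅, hf⟩ := h
  have key := @isSpecialAngle_or _ a b t₁ t₂ t₃ t₄ t₅ hf ρ hρ
  by_cases hex : ∃ τ, 0 < τ ∧ τ < 1 / 2 ∧ 2 * Real.cos (Real.pi * τ) = |a - ρ|
  · obtain ⟨τ, h0, h1, hτ⟩ := hex
    refine ⟨τ, fun t ht ht' h2 h3 => (key ht ht' h2 h3).imp id fun h4 => ?_⟩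
    exact two_mul_cos_sq_injOn ht ht' h0 h1 (by rw [h4, hτ])
  -- If `|a - ρ|` is not of the form `2 cos (π τ)` with `0 < τ < 1/2`, the exceptional case cannot
  -- occur and `0` is a dummy value.
  · exact ⟨0, fun t ht ht' h2 h3 => (key ht ht' h2 h3).imp id fun h4 => absurd ⟨t, ht, ht', h4⟩ hex⟩

section

variable {k : ℕ} {n : Fin k → ℕ} {τ : ℝ}

lemma two_mul_cos_lt_greatest [DecidableRel (starlikeTree n).Adj] {ρ : ℝ}
    (hρ : IsGreatest (graphEigenvalues (starlikeTree n)) ρ) {i : Fin k} (hi : 0 < n i) {t : ℝ}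
    (h1 : 1 / (i.val + 2 : ℕ) ≤ t) (h2 : t ≤ 1) : 2 * Real.cos (Real.pi * t) < ρ := by
  have h3 := branch_lt_greatest hρ hi
  have hpi := Real.pi_pos
  have := Real.cos_le_cos_of_nonneg_of_le_pi (x := Real.pi / (i.val + 2 : ℕ)) (y := Real.pi * t)
    (by positivity) (by nlinarith) (by
      rw [← mul_one_div]
      gcongr)
  linarith

lemma hasGaps [DecidableRel (starlikeTree n).Adj] {ρ : ℝ}
    (hρ : IsGreatest (graphEigenvalues (starlikeTree n)) ρ)
    (h : EigenvaluesBelow (graphCharpoly (starlikeTree n)) ρ τ) : HasGaps n τ := by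
  intro i i' j j' hi hi' hj hlt hle
  obtain ⟨t, h1, h2, h3⟩ := exists_newAngle hi hi' hj hlt hle
  have h0 : 0 < t := lt_of_le_of_lt (by positivity) h1
  have hj1 : (1 : ℝ) ≤ j := by exact_mod_cast hj
  refine ⟨t, h1, h2, h3, h t h0 (h2.trans_le hle) (h3.aeval_eq_zero h0 (by linarith))
    (two_mul_cos_lt_greatest hρ hi (le_trans ?_ h1.le) (by linarith))⟩
  gcongr

/-- For a longer branch, the gap between its first two poles lies below `1/6` and another gap lies
in `[2/5, 1/2]`. Neither contains a special angle, so both would have to contain `τ`. -/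
lemma HasGaps.branch_bound (h : HasGaps n τ) {i : Fin k} (hi : 0 < n i) :
    i.val ≤ 9 ∨ i.val = 11 := by
  by_contra hcon
  have h10 : 10 ≤ i.val := by omega
  have h10' : (10 : ℝ) ≤ i.val := by exact_mod_cast h10
  obtain ⟨t, h1, h2, -, h3⟩ := h i i 1 2 hi hi one_pos
    (by push_cast; gcongr; norm_num)
    (by rw [div_le_div_iff₀ (by positivity) (by norm_num)]; push_cast; linarith)
  have h2' : t < 1 / 6 := by
    refine h2.trans_le ?_
    rw [div_le_div_iff₀ (by positivity) (by norm_num)]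
    push_cast
    linarith
  have hτ : τ < 1 / 6 := by
    rcases h3 with (h3 | h3 | h3 | h3 | h3) | h3 <;> linarith
  -- Such a `j` exists for denominator `i + 2 = 12` and for all from `14` on, but not for `13`;
  -- hence index `11` survives.
  obtain ⟨j, hj0, hj1, hj2⟩ : ∃ j : ℕ, 0 < j ∧ 2 * (i.val + 2) ≤ 5 * j ∧ 2 * (j + 1) ≤ i.val + 2 := by
    refine ⟨i.val / 2, by omega, by omega, by omega⟩
  have hj1' : (2 : ℝ) * (i.val + 2) ≤ 5 * j := by exact_mod_cast hj1
  have hj2' : (2 : ℝ) * (j + 1) ≤ i.val + 2 := by exact_mod_cast hj2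
  obtain ⟨s, s1, s2, -, s3⟩ := h i i j (j + 1) hi hi hj0
    (by push_cast; gcongr; linarith)
    (by rw [div_le_div_iff₀ (by positivity) (by norm_num)]; push_cast; linarith)
  have s1' : 2 / 5 < s := by
    refine lt_of_le_of_lt ?_ s1
    rw [div_le_div_iff₀ (by norm_num) (by positivity)]
    push_cast
    linarith
  rcases s3 with (h3 | h3 | h3 | h3 | h3) | h3 <;> linarith

/-- Two copies make every branch angle `j/(i+2)` below `1/2` an eigenvalue angle. The first is below
`1/6`, hence equals `τ`, so all others are special. The choices `j = 2, 3` force `i + 2 = 12`, and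
then `j = 5` fails. -/
lemma branch_unique [DecidableRel (starlikeTree n).Adj] {ρ : ℝ}
    (hρ : IsGreatest (graphEigenvalues (starlikeTree n)) ρ)
    (h : EigenvaluesBelow (graphCharpoly (starlikeTree n)) ρ τ) {i : Fin k} (hi : 5 ≤ i.val) :
    n i ≤ 1 := by
  by_contra hn
  have hn0 : 0 < n i := by omega
  have hi' : (5 : ℝ) ≤ i.val := by exact_mod_cast hi
  have hpi := Real.pi_pos
  have key : ∀ j : ℕ, 0 < j → 2 * j < i.val + 2 →
      IsSpecialAngle ((j : ℝ) / (i.val + 2 : ℕ)) ∨ (j : ℝ) / (i.val + 2 : ℕ) = τ := by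
    intro j hj hj'
    have hj1 : (1 : ℝ) ≤ j := by exact_mod_cast hj
    have hj2 : (2 : ℝ) * j < i.val + 2 := by exact_mod_cast hj'
    have hlt : (j : ℝ) / (i.val + 2 : ℕ) < 1 / 2 := by
      rw [div_lt_div_iff₀ (by positivity) (by norm_num)]
      push_cast
      linarith
    have h0 : 0 < (j : ℝ) / (i.val + 2 : ℕ) := by positivity
    refine h _ h0 hlt (aeval_starlike_eq_zero n (i := i) (by omega) ?_)
      (two_mul_cos_lt_greatest hρ hn0 (by gcongr) (by linarith))
    have hs : 0 < Real.sin (Real.pi * ((j : ℝ) / (i.val + 2 : ℕ))) :=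
      Real.sin_pos_of_pos_of_lt_pi (by positivity) (by nlinarith)
    refine (mul_eq_zero.1 ?_).resolve_right hs.ne'
    rw [pathVal_two_mul_cos, Real.sin_eq_zero_iff]
    refine ⟨j, ?_⟩
    have : ((i.val + 2 : ℕ) : ℝ) ≠ 0 := by positivity
    field_simp
    simp
  have hne : ((i.val + 2 : ℕ) : ℝ) ≠ 0 := by positivity
  have key' : ∀ j : ℕ, 2 ≤ j → 2 * j < i.val + 2 → 3 * j = i.val + 2 ∨ 4 * j = i.val + 2 ∨
      5 * j = i.val + 2 ∨ 5 * j = 2 * (i.val + 2) ∨ 6 * j = i.val + 2 := by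
    have h1 : (((1 : ℕ) : ℝ)) / (i.val + 2 : ℕ) = τ := by
      refine (key 1 one_pos (by omega)).resolve_left fun h1 => ?_
      have : (((1 : ℕ) : ℝ)) / (i.val + 2 : ℕ) < 1 / 6 := by
        rw [div_lt_div_iff₀ (by positivity) (by norm_num)]
        push_cast
        linarith
      rcases h1 with h1 | h1 | h1 | h1 | h1 <;> linarith
    intro j hj hj'
    rcases key j (by omega) hj' with h2 | h2
    · rcases h2 with h2 | h2 | h2 | h2 | h2 <;> rw [div_eq_div_iff hne (by norm_num)] at h2
      · left; exact_mod_cast (by linarith : (3 : ℝ) * j = (i.val + 2 : ℕ))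
      · right; left; exact_mod_cast (by linarith : (4 : ℝ) * j = (i.val + 2 : ℕ))
      · right; right; left; exact_mod_cast (by linarith : (5 : ℝ) * j = (i.val + 2 : ℕ))
      · right; right; right; left; exact_mod_cast (by linarith : (5 : ℝ) * j = 2 * (i.val + 2 : ℕ))
      · right; right; right; right; exact_mod_cast (by linarith : (6 : ℝ) * j = (i.val + 2 : ℕ))
    · rw [← h1, div_left_inj' hne] at h2
      have : j = 1 := by exact_mod_cast h2
      omega
  have k2 := key' 2 le_rfl (by omega)
  have k3 := key' 3 (by norm_num) (by omega)
  have k5 := key' 5 (by norm_num)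
  omega

end

/-! ### The possible branch multiplicities -/

section Classification

/-- The condition that `1` is a new eigenvalue. -/
def ThirdEq (n : Fin 12 → ℕ) : Prop :=
  n 1 = 0 ∧ n 4 = 0 ∧ n 7 = 0 ∧ n 10 = 0 ∧ n 0 + n 3 + n 6 + n 9 = 1

/-- The condition that `√2` is a new eigenvalue. -/
def FourthEq (n : Fin 12 → ℕ) : Prop :=
  n 2 = 0 ∧ n 6 = 0 ∧ n 10 = 0 ∧ n 0 + n 4 + n 8 + 2 * (n 1 + n 5 + n 9) = 2

/-- The condition that the golden ratio or its inverse is a new eigenvalue. -/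
def FifthEq (n : Fin 12 → ℕ) : Prop :=
  n 3 = 0 ∧ n 8 = 0 ∧ n 0 + n 5 + n 10 + (n 2 + n 7) = 1 ∧ n 1 + n 6 + n 11 = n 0 + n 5 + n 10

/-- The condition that `√3` is a new eigenvalue. -/
def SixthEq (n : Fin 12 → ℕ) : Prop :=
  n 4 = 0 ∧ n 10 = 0 ∧ 2 * (n 0 + n 6) + 3 * (n 1 + n 7) + 4 * (n 2 + n 8) + 6 * (n 3 + n 9) = 6

variable {n : Fin 12 → ℕ} {τ : ℝ}

lemma HasGaps.cases (h : HasGaps n τ) {i i' : Fin 12} (hi : 0 < n i) (hi' : 0 < n i') (j j' : ℕ)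
    (p q : ℝ) (hpq : p = (j : ℝ) / (i.val + 2 : ℕ) ∧ q = (j' : ℝ) / (i'.val + 2 : ℕ) ∧ 0 < j ∧
      p < q ∧ q ≤ 1 / 2) :
    (p < 1 / 3 ∧ 1 / 3 < q ∧ ThirdEq n) ∨ (p < 1 / 4 ∧ 1 / 4 < q ∧ FourthEq n) ∨
    (p < 1 / 5 ∧ 1 / 5 < q ∧ FifthEq n) ∨ (p < 2 / 5 ∧ 2 / 5 < q ∧ FifthEq n) ∨
    (p < 1 / 6 ∧ 1 / 6 < q ∧ SixthEq n) ∨ (p < τ ∧ τ < q) := by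
  obtain ⟨rfl, rfl, hj, hlt, hle⟩ := hpq
  obtain ⟨t, h1, h2, h3, (rfl | rfl | rfl | rfl | rfl) | rfl⟩ := h i i' j j' hi hi' hj hlt hle
  · exact Or.inl ⟨h1, h2, h3.third_eq⟩
  · exact Or.inr (Or.inl ⟨h1, h2, h3.fourth_eq⟩)
  · exact Or.inr (Or.inr (Or.inl ⟨h1, h2, h3.fifth_eq⟩))
  · exact Or.inr (Or.inr (Or.inr (Or.inl ⟨h1, h2, h3.two_fifths_eq⟩)))
  · exact Or.inr (Or.inr (Or.inr (Or.inr (Or.inl ⟨h1, h2, h3.sixth_eq⟩))))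
  · exact Or.inr (Or.inr (Or.inr (Or.inr (Or.inr ⟨h1, h2⟩))))

/-- The gap `(1/13, 2/13)` uses up `τ`, so `(5/13, 6/13)` must be filled by `2/5`. The golden
equations then require a branch of index `0` or `5`, and each opens a further gap that nothing can
fill. -/
lemma HasGaps.eq_zero_eleven (h : HasGaps n τ) (h10 : n 10 = 0) (h11 : n 11 ≤ 1) : n 11 = 0 := by
  by_contra hcon
  have hp : 0 < n 11 := Nat.pos_of_ne_zero hcon
  have g1 := h.cases hp hp 1 2 (1 / 13) (2 / 13) (by norm_num)
  have g2 := h.cases hp hp 5 6 (5 / 13) (6 / 13) (by norm_num)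
  have f0 := fun h0 : 0 < n 0 => h.cases hp h0 6 1 (6 / 13) (1 / 2) (by norm_num)
  have f5 := fun h5 : 0 < n 5 => h.cases h5 hp 3 6 (3 / 7) (6 / 13) (by norm_num)
  norm_num at g1 g2 f0 f5
  grind [FifthEq]

/-- The three gaps contain only `1/6`, `1/3` and `2/5` respectively, and `τ` fills at most one. Any
two of the associated equations leave fewer than three branches. The eliminations of shorter
branches follow the same pattern, with extra gaps between poles of different branches where needed.
-/
lemma HasGaps.eq_zero_nine (h : HasGaps n τ) (hs : 3 ≤ n 0 + n 1 + n 2 + n 3 + n 4 + n 5 + n 6 +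
    n 7 + n 8 + n 9) (h11 : n 11 = 0) (h10 : n 10 = 0) (h5 : n 5 ≤ 1) (h9 : n 9 ≤ 1) :
    n 9 = 0 := by
  by_contra hcon
  have hp : 0 < n 9 := Nat.pos_of_ne_zero hcon
  have g1 := h.cases hp hp 1 2 (1 / 11) (2 / 11) (by norm_num)
  have g2 := h.cases hp hp 3 4 (3 / 11) (4 / 11) (by norm_num)
  have g3 := h.cases hp hp 4 5 (4 / 11) (5 / 11) (by norm_num)
  norm_num at g1 g2 g3
  grind [ThirdEq, FifthEq, SixthEq]

lemma HasGaps.eq_zero_eight (h : HasGaps n τ) (hs : 3 ≤ n 0 + n 1 + n 2 + n 3 + n 4 + n 5 + n 6 +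
    n 7 + n 8) (h9 : n 9 = 0) (h8 : n 8 ≤ 1) : n 8 = 0 := by
  by_contra hcon
  have hp : 0 < n 8 := Nat.pos_of_ne_zero hcon
  have g1 := h.cases hp hp 1 2 (1 / 10) (2 / 10) (by norm_num)
  have g2 := h.cases hp hp 2 3 (2 / 10) (3 / 10) (by norm_num)
  have g3 := h.cases hp hp 4 5 (4 / 10) (1 / 2) (by norm_num)
  norm_num at g1 g2 g3
  grind [FourthEq, SixthEq]

lemma HasGaps.eq_zero_seven (h : HasGaps n τ) (hs : 3 ≤ n 0 + n 1 + n 2 + n 3 + n 4 + n 5 + n 6 +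
    n 7) (h11 : n 11 = 0) (h10 : n 10 = 0) (h9 : n 9 = 0) (h8 : n 8 = 0) (h7 : n 7 ≤ 1) :
    n 7 = 0 := by
  by_contra hcon
  have hp : 0 < n 7 := Nat.pos_of_ne_zero hcon
  have g1 := h.cases hp hp 1 2 (1 / 9) (2 / 9) (by norm_num)
  have g2 := h.cases hp hp 2 3 (2 / 9) (1 / 3) (by norm_num)
  have g3 := h.cases hp hp 3 4 (1 / 3) (4 / 9) (by norm_num)
  have f5 := fun h5 : 0 < n 5 => h.cases h5 hp 3 4 (3 / 7) (4 / 9) (by norm_num)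
  have f4 := fun h4 : 0 < n 4 => h.cases hp h4 4 3 (4 / 9) (1 / 2) (by norm_num)
  have f4' := fun h4 : 0 < n 4 => h.cases hp h4 1 1 (1 / 9) (1 / 6) (by norm_num)
  norm_num at g1 g2 g3 f5 f4 f4'
  grind [FourthEq, FifthEq, SixthEq]

lemma HasGaps.eq_zero_six (h : HasGaps n τ) (hs : 3 ≤ n 0 + n 1 + n 2 + n 3 + n 4 + n 5 + n 6)
    (h11 : n 11 = 0) (h10 : n 10 = 0) (h9 : n 9 = 0) (h8 : n 8 = 0) (h7 : n 7 = 0)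
    (h6 : n 6 ≤ 1) : n 6 = 0 := by
  by_contra hcon
  have hp : 0 < n 6 := Nat.pos_of_ne_zero hcon
  have g1 := h.cases hp hp 1 2 (1 / 8) (1 / 4) (by norm_num)
  have g2 := h.cases hp hp 2 3 (1 / 4) (3 / 8) (by norm_num)
  have g3 := h.cases hp hp 3 4 (3 / 8) (1 / 2) (by norm_num)
  have f5 := fun h5 : 0 < n 5 => h.cases hp h5 1 1 (1 / 8) (1 / 7) (by norm_num)
  have f5' := fun h5 : 0 < n 5 => h.cases h5 hp 3 4 (3 / 7) (1 / 2) (by norm_num)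
  have f4 := fun h4 : 0 < n 4 => h.cases hp h4 1 1 (1 / 8) (1 / 6) (by norm_num)
  have f4' := fun h4 : 0 < n 4 => h.cases hp h4 2 2 (1 / 4) (1 / 3) (by norm_num)
  norm_num at g1 g2 g3 f5 f5' f4 f4'
  grind [ThirdEq, FifthEq, SixthEq]

lemma HasGaps.eq_zero_five (h : HasGaps n τ) (hs : 3 ≤ n 0 + n 1 + n 2 + n 3 + n 4 + n 5)
    (h11 : n 11 = 0) (h10 : n 10 = 0) (h9 : n 9 = 0) (h8 : n 8 = 0) (h7 : n 7 = 0) (h6 : n 6 = 0)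
    (h5 : n 5 ≤ 1) : n 5 = 0 := by
  by_contra hcon
  have hp : 0 < n 5 := Nat.pos_of_ne_zero hcon
  have g1 := h.cases hp hp 1 2 (1 / 7) (2 / 7) (by norm_num)
  have g2 := h.cases hp hp 2 3 (2 / 7) (3 / 7) (by norm_num)
  have f3 := fun h3 : 0 < n 3 => h.cases h3 hp 2 3 (2 / 5) (3 / 7) (by norm_num)
  have f3' := fun h3 : 0 < n 3 => h.cases hp h3 2 2 (2 / 7) (2 / 5) (by norm_num)
  have f4 := fun h4 : 0 < n 4 => h.cases hp h4 1 1 (1 / 7) (1 / 6) (by norm_num)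
  have f4' := fun h4 : 0 < n 4 => h.cases hp h4 3 3 (3 / 7) (1 / 2) (by norm_num)
  have f0 := fun h0 : 0 < n 0 => h.cases hp h0 3 1 (3 / 7) (1 / 2) (by norm_num)
  have f2 := fun h2 : 0 < n 2 => h.cases hp h2 3 2 (3 / 7) (1 / 2) (by norm_num)
  have f2' := fun h2 : 0 < n 2 => h.cases h2 hp 1 2 (1 / 4) (2 / 7) (by norm_num)
  have f1 := fun h1 : 0 < n 1 => h.cases hp h1 2 1 (2 / 7) (1 / 3) (by norm_num)
  have f1' := fun h1 : 0 < n 1 => h.cases h1 hp 1 3 (1 / 3) (3 / 7) (by norm_num)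
  norm_num at g1 g2 f3 f3' f4 f4' f0 f2 f2' f1 f1'
  grind [ThirdEq, FourthEq, FifthEq, SixthEq]

/-- The possible multiplicities of the branches, when all have at most five vertices. -/
def ShortBranches (m : Fin 12 → ℕ) : Prop :=
  (m 1 = 0 ∧ m 2 = 0 ∧ m 3 = 0 ∧ m 4 = 0) ∨ (m 0 = 0 ∧ m 2 = 0 ∧ m 3 = 0 ∧ m 4 = 0) ∨
  (0 < m 0 ∧ 0 < m 1 ∧ m 2 = 0 ∧ m 3 = 0 ∧ m 4 = 0) ∨ (m 1 = 0 ∧ 0 < m 2 ∧ m 3 = 0 ∧ m 4 = 0) ∨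
  (m 0 = 0 ∧ m 1 = 0 ∧ m 2 = 0 ∧ 0 < m 3 ∧ m 4 = 0) ∨
  (m 0 = 2 ∧ m 1 = 0 ∧ m 2 = 0 ∧ 0 < m 3 ∧ m 4 = 0) ∨
  (m 0 = 0 ∧ m 1 = 1 ∧ m 2 = 0 ∧ 0 < m 3 ∧ m 4 = 0) ∨
  (m 0 = 1 ∧ m 1 = 1 ∧ m 2 = 0 ∧ m 3 = 0 ∧ 0 < m 4) ∨
  (m 0 = 0 ∧ m 1 = 0 ∧ m 2 = 1 ∧ m 3 = 0 ∧ 0 < m 4)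

/-- Gaps between poles of two branch types restrict which types coexist. A gap free of special
angles fixes the position of `τ`, and the next gap then yields an equation for the multiplicities.
-/
lemma HasGaps.shortBranches (h : HasGaps n τ) (hs : 3 ≤ n 0 + n 1 + n 2 + n 3 + n 4)
    (h11 : n 11 = 0) (h10 : n 10 = 0) (h9 : n 9 = 0) (h8 : n 8 = 0) (h7 : n 7 = 0) (h6 : n 6 = 0)
    (h5 : n 5 = 0) : ShortBranches n := by
  have f32 := fun (h3 : 0 < n 3) (h2 : 0 < n 2) => h.cases h3 h2 1 1 (1 / 5) (1 / 4) (by norm_num)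
  have f32' := fun (h3 : 0 < n 3) (h2 : 0 < n 2) => h.cases h3 h2 2 2 (2 / 5) (1 / 2) (by norm_num)
  have f34 := fun (h3 : 0 < n 3) (h4 : 0 < n 4) => h.cases h4 h3 2 2 (1 / 3) (2 / 5) (by norm_num)
  have f34' := fun (h3 : 0 < n 3) (h4 : 0 < n 4) => h.cases h3 h4 2 3 (2 / 5) (1 / 2) (by norm_num)
  have f30 := fun (h3 : 0 < n 3) (h0 : 0 < n 0) => h.cases h3 h0 2 1 (2 / 5) (1 / 2) (by norm_num)
  have f3 := fun (h3 : 0 < n 3) => h.cases h3 h3 1 2 (1 / 5) (2 / 5) (by norm_num)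
  have f31 := fun (h3 : 0 < n 3) (h1 : 0 < n 1) => h.cases h1 h3 1 2 (1 / 3) (2 / 5) (by norm_num)
  have f31' := fun (h3 : 0 < n 3) (h1 : 0 < n 1) => h.cases h3 h1 1 1 (1 / 5) (1 / 3) (by norm_num)
  have f12 := fun (h1 : 0 < n 1) (h2 : 0 < n 2) => h.cases h1 h2 1 2 (1 / 3) (1 / 2) (by norm_num)
  have f12' := fun (h1 : 0 < n 1) (h2 : 0 < n 2) => h.cases h2 h1 1 1 (1 / 4) (1 / 3) (by norm_num)
  have f4 := fun (h4 : 0 < n 4) => h.cases h4 h4 2 3 (1 / 3) (1 / 2) (by norm_num)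
  have f4' := fun (h4 : 0 < n 4) => h.cases h4 h4 1 2 (1 / 6) (1 / 3) (by norm_num)
  have f42 := fun (h4 : 0 < n 4) (h2 : 0 < n 2) => h.cases h2 h4 1 2 (1 / 4) (1 / 3) (by norm_num)
  norm_num at f32 f32' f34 f34' f30 f3 f31 f31' f12 f12' f4 f4' f42
  simp only [ShortBranches]
  rcases Nat.eq_zero_or_pos (n 3) with h3 | h3 <;> rcases Nat.eq_zero_or_pos (n 2) with h2 | h2 <;>
    rcases Nat.eq_zero_or_pos (n 4) with h4 | h4 <;> rcases Nat.eq_zero_or_pos (n 0) with h0 | h0 <;>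
    grind [ThirdEq, FourthEq, FifthEq]

end Classification

/-! ### Arithmetic of the largest eigenvalue -/

lemma irreducible_quadratic_iff (a b : ℤ) :
    Irreducible (X ^ 2 - C a * X + C b : ℤ[X]) ↔ ¬ IsSquare (a ^ 2 - 4 * b) := by
  have hdeg : (X ^ 2 - C a * X + C b : ℤ[X]).natDegree = 2 := by compute_degree!
  have hm : (X ^ 2 - C a * X + C b : ℤ[X]).Monic := by monicity!
  rw [hm.irreducible_iff_roots_eq_zero_of_degree_le_three hdeg.ge (by omega),
    Multiset.eq_zero_iff_forall_notMem]
  simp only [mem_roots hm.ne_zero, IsRoot.def, eval_add, eval_sub, eval_pow, eval_X, eval_mul,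
    eval_C]
  constructor
  · rintro h ⟨s, hs⟩
    -- If the discriminant is `s²`, then `a` and `s` have equal parity, so `(a + s)/2` is an integer
    -- root.
    have h2 : Even (a + s) := by
      have : Even (a ^ 2 - s ^ 2) := ⟨2 * b, by linarith⟩
      have h3 : Even ((a + s) * (a - s)) := by
        rwa [show (a + s) * (a - s) = a ^ 2 - s ^ 2 by ring]
      rcases Int.even_mul.1 h3 with h4 | h4
      · exact h4
      · rw [show a + s = (a - s) + 2 * s by ring]
        exact h4.add (even_two_mul s)
    obtain ⟨r, hr⟩ := h2
    refine h r ?_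
    have h5 : s = 2 * r - a := by linarith
    subst h5
    linarith
  · rintro h r hr
    exact h ⟨2 * r - a, by linear_combination -4 * hr⟩

section

variable {a b : ℤ} {ρ : ℝ}

lemma linear_combination_eq_zero (hD : ¬ IsSquare (a ^ 2 - 4 * b))
    (hρ : ρ ^ 2 - (a : ℝ) * ρ + (b : ℝ) = 0) {p q : ℤ} (h : (p : ℝ) * ρ + q = 0) :
    p = 0 ∧ q = 0 := by
  have hp : p = 0 := by
    by_contra hp
    have hp' : (p : ℝ) ≠ 0 := by exact_mod_cast hp
    apply hD
    rw [← Rat.isSquare_intCast_iff]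
    refine ⟨2 * (-q / p) - a, ?_⟩
    have hq : ρ = ((-q / p : ℚ) : ℝ) := by
      push_cast
      field_simp
      linarith
    rw [hq] at hρ
    have h2 : ((-q / p : ℚ)) ^ 2 - a * (-q / p : ℚ) + b = 0 := by exact_mod_cast hρ
    push_cast
    linear_combination -4 * h2
  subst hp
  simpa using h

/-- Reduce modulo `ρ² = aρ - b` and use that `1` and `ρ` are linearly independent over `ℤ`; since `a
≠ 0`, the coefficient of `ρ` determines `s`, and then `p`. -/
lemma biquadratic_eq (ha : 0 < a) (hD : ¬ IsSquare (a ^ 2 - 4 * b))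
    (hρ : ρ ^ 2 - (a : ℝ) * ρ + (b : ℝ) = 0) {s p : ℤ} (h : ρ ^ 4 - s * ρ ^ 2 + p = 0) :
    s = a ^ 2 - 2 * b ∧ p = b ^ 2 := by
  obtain ⟨h1, h2⟩ := linear_combination_eq_zero hD hρ (p := a * (a ^ 2 - 2 * b - s))
    (q := -a ^ 2 * b + b ^ 2 + s * b + p) (by
      push_cast
      linear_combination h - (ρ ^ 2 + a * ρ - b + a ^ 2 - s) * hρ)
  have hs : s = a ^ 2 - 2 * b := by
    rcases mul_eq_zero.1 h1 with h3 | h3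
    · omega
    · linarith
  subst hs
  exact ⟨rfl, by linarith⟩

lemma sq_ne_int (ha : 0 < a) (hD : ¬ IsSquare (a ^ 2 - 4 * b))
    (hρ : ρ ^ 2 - (a : ℝ) * ρ + (b : ℝ) = 0) (c : ℤ) : ρ ^ 2 - c ≠ 0 := fun h =>
  ha.ne' (linear_combination_eq_zero hD hρ (p := a) (q := -b - c) (by
    push_cast
    linear_combination h - hρ)).1

/-- The five families of admissible branch multiplicities. -/
def AdmissibleBranches (m : Fin 12 → ℕ) (a b : ℤ) : Prop :=
  (m 0 = 0 ∧ m 1 = 0 ∧ m 2 = 1 ∧ m 3 = 0 ∧ Cond₁ a b (m 4)) ∨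
  (m 0 = 0 ∧ m 1 = 0 ∧ m 2 = 0 ∧ m 4 = 0 ∧ Cond₂ a b (m 3)) ∨
  (m 0 = 2 ∧ m 1 = 0 ∧ m 2 = 0 ∧ m 4 = 0 ∧ Cond₃ a b (m 3)) ∨
  (m 1 = 0 ∧ m 3 = 0 ∧ m 4 = 0 ∧ Cond₄ a b (m 0) (m 2)) ∨
  (m 2 = 0 ∧ m 3 = 0 ∧ m 4 = 0 ∧ Cond₅ a b (m 0) (m 1))

/-- Clearing denominators turns each shape into an equation in `ρ²`, possibly after cancelling a
factor nonzero at `ρ`. Linear equations contradict `sq_ne_int`; quadratic ones are read off by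
`biquadratic_eq`. -/
lemma admissible_of_short {m : Fin 12 → ℕ} (hm : ShortBranches m)
    (hs : 3 ≤ m 0 + m 1 + m 2 + m 3 + m 4) (ha : 0 < a) (hD : ¬ IsSquare (a ^ 2 - 4 * b))
    (hρ : ρ ^ 2 - (a : ℝ) * ρ + (b : ℝ) = 0)
    (h1 : 0 < m 1 → 0 < pathVal ρ 3)
    (h3 : 0 < m 3 → 0 < pathVal ρ 5)
    (h4 : 0 < m 4 → 0 < pathVal ρ 6 ∧ 3 < ρ ^ 2)
    (hsum : ρ = m 0 * (1 / pathVal ρ 2) + m 1 * (pathVal ρ 2 / pathVal ρ 3) +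
      m 2 * (pathVal ρ 3 / pathVal ρ 4) + m 3 * (pathVal ρ 4 / pathVal ρ 5) +
      m 4 * (pathVal ρ 5 / pathVal ρ 6)) : AdmissibleBranches m a b := by
  have hρ0 : ρ ≠ 0 := fun h => by
    have := (linear_combination_eq_zero hD hρ (p := 1) (q := 0) (by simpa using h)).1
    omega
  have hY2 : ρ ^ 2 - 2 ≠ 0 := by exact_mod_cast sq_ne_int ha hD hρ 2
  have u2 : pathVal ρ 2 = ρ := by simp [pathVal_add_two ρ 0]
  have u3 : pathVal ρ 3 = ρ ^ 2 - 1 := by rw [pathVal_add_two ρ 1, u2, pathVal_one]; ring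
  have u4 : pathVal ρ 4 = ρ * (ρ ^ 2 - 2) := by rw [pathVal_add_two ρ 2, u2, u3]; ring
  have u5 : pathVal ρ 5 = ρ ^ 2 * (ρ ^ 2 - 3) + 1 := by rw [pathVal_add_two ρ 3, u3, u4]; ring
  have u6 : pathVal ρ 6 = ρ * (ρ ^ 4 - 4 * ρ ^ 2 + 3) := by
    rw [pathVal_add_two ρ 4, u4, u5]; ring
  rw [u2, u3, u4, u5, u6] at hsum
  rw [u3] at h1
  rw [u5] at h3
  rw [u6] at h4
  unfold AdmissibleBranches
  rcases hm with ⟨e1, e2, e3, e4⟩ | ⟨e0, e2, e3, e4⟩ | ⟨e0, e1, e2, e3, e4⟩ | ⟨e1, e2, e3, e4⟩ |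
    ⟨e0, e1, e2, e3, e4⟩ | ⟨e0, e1, e2, e3, e4⟩ | ⟨e0, e1, e2, e3, e4⟩ | ⟨e0, e1, e2, e3, e4⟩ |
    ⟨e0, e1, e2, e3, e4⟩
  · exfalso
    simp only [e1, e2, e3, e4, Nat.cast_zero, Nat.cast_one, Nat.cast_ofNat, zero_mul, add_zero, zero_add, one_mul] at hsum
    refine sq_ne_int ha hD hρ (m 0) ?_
    field_simp at hsum
    push_cast at hsum ⊢
    linarith
  · exfalso
    have hp := h1 (by omega)
    simp only [e0, e2, e3, e4, Nat.cast_zero, Nat.cast_one, Nat.cast_ofNat, zero_mul, add_zero, zero_add, one_mul] at hsum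
    refine sq_ne_int ha hD hρ (m 1 + 1) ?_
    field_simp at hsum
    push_cast at hsum ⊢
    linarith
  · have hp := h1 e1
    simp only [e2, e3, e4, Nat.cast_zero, Nat.cast_one, Nat.cast_ofNat, zero_mul, add_zero, zero_add, one_mul] at hsum
    obtain ⟨k1, k2⟩ := biquadratic_eq ha hD hρ (s := m 0 + m 1 + 1) (p := m 0) (by
      field_simp at hsum
      push_cast at hsum ⊢
      linarith)
    right; right; right; right
    exact ⟨e2, e3, e4, k2, e0, by linarith, e1, by omega⟩
  · simp only [e1, e3, e4, Nat.cast_zero, Nat.cast_one, Nat.cast_ofNat, zero_mul, add_zero, zero_add, one_mul] at hsum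
    obtain ⟨k1, k2⟩ := biquadratic_eq ha hD hρ (s := 2 + m 0 + m 2) (p := 2 * m 0 + m 2) (by
      field_simp at hsum
      push_cast at hsum ⊢
      linarith)
    right; right; right; left
    exact ⟨e1, e3, e4, by linarith, by linarith, e2, by omega⟩
  · have hp := h3 e3
    simp only [e0, e1, e2, e4, Nat.cast_zero, Nat.cast_one, Nat.cast_ofNat, zero_mul, add_zero, zero_add, one_mul] at hsum
    obtain ⟨k1, k2⟩ := biquadratic_eq ha hD hρ (s := 3 + m 3) (p := 1 + 2 * m 3) (by
      field_simp at hsum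
      push_cast at hsum ⊢
      linarith)
    right; left
    exact ⟨e0, e1, e2, e4, by linarith, by omega, by linarith⟩
  · have hp := h3 e3
    simp only [e0, e1, e2, e4, Nat.cast_zero, Nat.cast_one, Nat.cast_ofNat, zero_mul, add_zero, zero_add, one_mul] at hsum
    obtain ⟨k1, k2⟩ := biquadratic_eq ha hD hρ (s := 3 + m 3) (p := 1) (by
      field_simp at hsum
      push_cast at hsum ⊢
      refine (mul_eq_zero.1 ?_).resolve_left hY2
      linarith)
    right; right; left
    refine ⟨e0, e1, e2, e4, e3, ?_⟩
    rcases sq_eq_one_iff.1 k2.symm with rfl | rfl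
    · left; constructor <;> linarith
    · right; constructor <;> linarith
  · exfalso
    have hp := h3 e3
    have hp1 := h1 (by omega)
    simp only [e0, e1, e2, e4, Nat.cast_zero, Nat.cast_one, Nat.cast_ofNat, zero_mul, add_zero, zero_add, one_mul] at hsum
    obtain ⟨k1, k2⟩ := biquadratic_eq ha hD hρ (s := 3 + m 3) (p := 1 + m 3) (by
      field_simp at hsum
      push_cast at hsum ⊢
      refine (mul_eq_zero.1 ?_).resolve_left hY2
      linarith)
    -- Eliminating `m 3` leaves a difference of squares equal to `1`, hence `b = -1` and `m 3 = 0`.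
    have hab : (a - (b + 1)) * (a + (b + 1)) = 1 := by linarith
    have : b = -1 := by
      rcases Int.mul_eq_one_iff_eq_one_or_neg_one.1 hab with ⟨h5, h6⟩ | ⟨h5, h6⟩ <;> omega
    subst this
    omega
  · exfalso
    obtain ⟨hp, hp3⟩ := h4 e4
    have hp1 := h1 (by omega)
    simp only [e0, e1, e2, e3, Nat.cast_zero, Nat.cast_one, Nat.cast_ofNat, zero_mul, add_zero, zero_add, one_mul] at hsum
    have hp' : ρ ^ 4 - 4 * ρ ^ 2 + 3 ≠ 0 := fun h => by simp [h] at hp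
    have hq : ρ ^ 2 * (ρ ^ 2 - 3) + 1 ≠ 0 := by nlinarith
    refine sq_ne_int ha hD hρ (3 + m 4) ((mul_eq_zero.1 ?_).resolve_left hq)
    have hp'' : ρ ^ 4 - 4 * ρ ^ 2 + 3 = (ρ ^ 2 - 1) * (ρ ^ 2 - 3) := by ring
    have hp3' : ρ ^ 2 - 3 ≠ 0 := by linarith
    rw [hp''] at hsum
    field_simp at hsum
    push_cast at hsum ⊢
    linarith
  · obtain ⟨hp, hp3⟩ := h4 e4
    simp only [e0, e1, e2, e3, Nat.cast_zero, Nat.cast_one, Nat.cast_ofNat, zero_mul, add_zero, zero_add, one_mul] at hsum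
    have hp1 : ρ ^ 2 - 1 ≠ 0 := by linarith
    have hp'' : ρ ^ 4 - 4 * ρ ^ 2 + 3 = (ρ ^ 2 - 1) * (ρ ^ 2 - 3) := by ring
    have hp3' : ρ ^ 2 - 3 ≠ 0 := by linarith
    have hq : ρ ^ 2 * (ρ ^ 2 - 3) + 1 ≠ 0 := by nlinarith
    rw [hp''] at hsum
    obtain ⟨k1, k2⟩ := biquadratic_eq ha hD hρ (s := 4 + m 4) (p := 3 + 2 * m 4) (by
      field_simp at hsum
      push_cast at hsum ⊢
      refine (mul_eq_zero.1 ?_).resolve_left hq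
      linarith)
    left
    exact ⟨e0, e1, e2, e3, by linarith, by omega, by linarith⟩

end

/-! ### Characteristic polynomials of the five families -/

lemma intPoly_eq_of_aeval {p q : ℤ[X]} (h : ∀ x : ℝ, 2 ≤ x → aeval x p = aeval x q) : p = q := by
  apply Polynomial.map_injective (Int.castRingHom ℝ) Int.cast_injective
  refine Polynomial.eq_of_infinite_eval_eq _ _ ((Set.Ici_infinite (2 : ℝ)).mono fun x hx => ?_)
  simp only [Set.mem_ofPred_eq, eval_map]
  rw [← algebraMap_int_eq, ← aeval_def, h x hx, ← aeval_def]

lemma pathVal_small (x : ℝ) : pathVal x 2 = x ∧ pathVal x 3 = x ^ 2 - 1 ∧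
    pathVal x 4 = x * (x ^ 2 - 2) ∧ pathVal x 5 = (x ^ 2 - x - 1) * (x ^ 2 + x - 1) ∧
    pathVal x 6 = x * ((x ^ 2 - 1) * (x ^ 2 - 3)) := by
  have u2 : pathVal x 2 = x := by simp [pathVal_add_two x 0]
  have u3 : pathVal x 3 = x ^ 2 - 1 := by rw [pathVal_add_two x 1, u2, pathVal_one]; ring
  have u4 : pathVal x 4 = x * (x ^ 2 - 2) := by rw [pathVal_add_two x 2, u2, u3]; ring
  have u5 : pathVal x 5 = (x ^ 2 - x - 1) * (x ^ 2 + x - 1) := by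
    rw [pathVal_add_two x 3, u3, u4]; ring
  exact ⟨u2, u3, u4, u5, by rw [pathVal_add_two x 4, u4, u5]; ring⟩

section Families

variable {V : Type*} [Fintype V] [DecidableEq V] {T : SimpleGraph V} [DecidableRel T.Adj]
  {a b : ℤ}

lemma aeval_of_iso {k : ℕ} {n : Fin k → ℕ} (e : T ≃g starlikeTree n) {x : ℝ} (hx : 2 ≤ x) :
    aeval x (graphCharpoly T) = (∏ i : Fin k, pathVal x (i.val + 2) ^ n i) *
      (x - ∑ i : Fin k, n i * (pathVal x (i.val + 1) / pathVal x (i.val + 2))) := by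
  classical
  rw [graphCharpoly_iso e, aeval_starlike_of_two_le n hx]

theorem charpoly_family₁ {n₅ : ℕ} (h : Cond₁ a b n₅) (e : T ≃g starlikeTree ![0, 0, 1, 0, n₅]) :
    graphCharpoly T = X ^ n₅ * (X ^ 2 - 1) ^ (n₅ - 1) * (X ^ 2 - X - 1) * (X ^ 2 + X - 1)
      * (X ^ 2 - 3) ^ (n₅ - 1) * (X ^ 2 - C a * X + C b) * (X ^ 2 + C a * X + C b) := by
  obtain ⟨h1, h2, h3⟩ := h
  obtain ⟨d, rfl⟩ : ∃ d, n₅ = d + 1 := ⟨n₅ - 1, by omega⟩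
  refine intPoly_eq_of_aeval fun x hx => ?_
  have h1' : 2 * ((d : ℝ) + 1) = b ^ 2 - 3 := by exact_mod_cast h1
  have h3' : 2 * (a : ℝ) ^ 2 = (b + 2) ^ 2 + 1 := by exact_mod_cast h3
  obtain ⟨u2, u3, u4, u5, u6⟩ := pathVal_small x
  have hx0 : x ≠ 0 := by linarith
  have hx2 : x ^ 2 - 2 ≠ 0 := by nlinarith
  have hx1 : x ^ 2 - 1 ≠ 0 := by nlinarith
  have hx3 : x ^ 2 - 3 ≠ 0 := by nlinarith
  rw [aeval_of_iso e hx]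
  simp only [Fin.prod_univ_five, Fin.sum_univ_five]
  simp [u2, u3, u4, u5, u6, map_ofNat]
  -- Only one copy of each occurring branch type is needed to clear denominators; the remaining `d`
  -- copies supply the repeated factors of the final polynomial. The other families work the same
  -- way.
  have key : x * (x ^ 2 - 2) * (x * ((x ^ 2 - 1) * (x ^ 2 - 3))) *
      (x - ((x ^ 2 - 1) / (x * (x ^ 2 - 2)) +
        ((d : ℝ) + 1) * ((x ^ 2 - x - 1) * (x ^ 2 + x - 1) / (x * ((x ^ 2 - 1) * (x ^ 2 - 3)))))) =
      x * ((x ^ 2 - x - 1) * (x ^ 2 + x - 1) * ((x ^ 2 - a * x + b) * (x ^ 2 + a * x + b))) := by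
    field_simp
    linear_combination (-(x ^ 2 - 2) * (x ^ 2 - x - 1) * (x ^ 2 + x - 1) / 2) * h1' +
      (x ^ 2 * (x ^ 2 - x - 1) * (x ^ 2 + x - 1) / 2) * h3'
  rw [pow_succ, mul_pow, mul_pow, pow_succ x d]
  linear_combination (x ^ d * (x ^ 2 - 1) ^ d * (x ^ 2 - 3) ^ d) * key

theorem charpoly_family₂ {n₄ : ℕ} (h : Cond₂ a b n₄) (e : T ≃g starlikeTree ![0, 0, 0, n₄]) :
    graphCharpoly T = X * ((X ^ 2 - X - 1) * (X ^ 2 + X - 1)) ^ (n₄ - 1)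
      * (X ^ 2 - C a * X + C b) * (X ^ 2 + C a * X + C b) := by
  obtain ⟨h1, h2, h3⟩ := h
  obtain ⟨d, rfl⟩ : ∃ d, n₄ = d + 1 := ⟨n₄ - 1, by omega⟩
  refine intPoly_eq_of_aeval fun x hx => ?_
  have h1' : 2 * ((d : ℝ) + 1) = b ^ 2 - 1 := by exact_mod_cast h1
  have h3' : 2 * (a : ℝ) ^ 2 = (b + 2) ^ 2 + 1 := by exact_mod_cast h3
  obtain ⟨u2, u3, u4, u5, u6⟩ := pathVal_small x
  have hx0 : x ≠ 0 := by linarith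
  have hx4 : x * (x - 1) - 1 ≠ 0 := by nlinarith
  have hx5 : x * (x + 1) - 1 ≠ 0 := by nlinarith
  rw [aeval_of_iso e hx]
  simp only [Fin.prod_univ_four, Fin.sum_univ_four]
  simp [u2, u3, u4, u5]
  have key : (x ^ 2 - x - 1) * (x ^ 2 + x - 1) *
      (x - ((d : ℝ) + 1) * (x * (x ^ 2 - 2) / ((x ^ 2 - x - 1) * (x ^ 2 + x - 1)))) =
      x * ((x ^ 2 - a * x + b) * (x ^ 2 + a * x + b)) := by
    field_simp
    linear_combination (-(x ^ 2 - 2) / 2) * h1' + (x ^ 2 / 2) * h3'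
  rw [pow_succ]
  linear_combination (((x ^ 2 - x - 1) * (x ^ 2 + x - 1)) ^ d) * key

theorem charpoly_family₃ {n₄ : ℕ} (h : Cond₃ a b n₄) (e : T ≃g starlikeTree ![2, 0, 0, n₄]) :
    graphCharpoly T = X * (X ^ 2 - 2) * ((X ^ 2 - X - 1) * (X ^ 2 + X - 1)) ^ (n₄ - 1)
      * (X ^ 2 - C a * X + C b) * (X ^ 2 + C a * X + C b) := by
  obtain ⟨h2, h⟩ := h
  obtain ⟨d, rfl⟩ : ∃ d, n₄ = d + 1 := ⟨n₄ - 1, by omega⟩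
  refine intPoly_eq_of_aeval fun x hx => ?_
  -- Both alternatives of the condition say `b² = 1` and `n₄ = a² - 2b - 3`, which is all the
  -- identity needs.
  obtain ⟨hs, hb⟩ : (d : ℝ) + 1 = a ^ 2 - 2 * b - 3 ∧ (b : ℝ) ^ 2 = 1 := by
    rcases h with ⟨h, rfl⟩ | ⟨h, rfl⟩
    · have : (d : ℝ) + 1 = a ^ 2 - 5 := by exact_mod_cast h
      constructor <;> push_cast <;> linarith
    · have : (d : ℝ) + 1 = a ^ 2 - 1 := by exact_mod_cast h
      constructor <;> push_cast <;> linarith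
  obtain ⟨u2, u3, u4, u5, u6⟩ := pathVal_small x
  have hx0 : x ≠ 0 := by linarith
  have hx4 : x * (x - 1) - 1 ≠ 0 := by nlinarith
  have hx5 : x * (x + 1) - 1 ≠ 0 := by nlinarith
  rw [aeval_of_iso e hx]
  simp only [Fin.prod_univ_four, Fin.sum_univ_four]
  simp [u2, u3, u4, u5, map_ofNat]
  have key : x ^ 2 * ((x ^ 2 - x - 1) * (x ^ 2 + x - 1)) *
      (x - (2 * x⁻¹ +
        ((d : ℝ) + 1) * (x * (x ^ 2 - 2) / ((x ^ 2 - x - 1) * (x ^ 2 + x - 1))))) =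
      x * (x ^ 2 - 2) * ((x ^ 2 - a * x + b) * (x ^ 2 + a * x + b)) := by
    field_simp
    linear_combination (-(x ^ 2 - 2) * x ^ 2) * hs - (x ^ 2 - 2) * hb
  rw [pow_succ]
  linear_combination (((x ^ 2 - x - 1) * (x ^ 2 + x - 1)) ^ d) * key

theorem charpoly_family₄ {n₁ n₃ : ℕ} (h : Cond₄ a b n₁ n₃) (e : T ≃g starlikeTree ![n₁, 0, n₃]) :
    graphCharpoly T = X ^ (n₁ + n₃ - 1) * (X ^ 2 - 2) ^ (n₃ - 1)
      * (X ^ 2 - C a * X + C b) * (X ^ 2 + C a * X + C b) := by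
  obtain ⟨h1, h3, h4, -⟩ := h
  obtain ⟨d, rfl⟩ : ∃ d, n₃ = d + 1 := ⟨n₃ - 1, by omega⟩
  refine intPoly_eq_of_aeval fun x hx => ?_
  have h1' : (n₁ : ℝ) = -a ^ 2 + (b + 1) ^ 2 + 1 := by exact_mod_cast h1
  have h3' : (d : ℝ) + 1 = 2 * a ^ 2 - (b + 2) ^ 2 := by exact_mod_cast h3
  obtain ⟨u2, u3, u4, u5, u6⟩ := pathVal_small x
  have hx0 : x ≠ 0 := by linarith
  have hx2 : x ^ 2 - 2 ≠ 0 := by nlinarith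
  rw [aeval_of_iso e hx]
  simp only [Fin.prod_univ_three, Fin.sum_univ_three]
  simp [u2, u3, u4, map_ofNat]
  have key : x * (x ^ 2 - 2) *
      (x - (n₁ * x⁻¹ + ((d : ℝ) + 1) * ((x ^ 2 - 1) / (x * (x ^ 2 - 2))))) =
      (x ^ 2 - a * x + b) * (x ^ 2 + a * x + b) := by
    field_simp
    rw [h1', h3']
    ring
  rw [pow_succ, mul_pow, pow_add]
  linear_combination (x ^ n₁ * x ^ d * (x ^ 2 - 2) ^ d) * key

theorem charpoly_family₅ {n₁ n₂ : ℕ} (h : Cond₅ a b n₁ n₂) (e : T ≃g starlikeTree ![n₁, n₂]) :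
    graphCharpoly T = X ^ (n₁ - 1) * (X ^ 2 - 1) ^ (n₂ - 1)
      * (X ^ 2 - C a * X + C b) * (X ^ 2 + C a * X + C b) := by
  obtain ⟨h1, h2, h3, h4, -⟩ := h
  obtain ⟨c, rfl⟩ : ∃ c, n₁ = c + 1 := ⟨n₁ - 1, by omega⟩
  obtain ⟨d, rfl⟩ : ∃ d, n₂ = d + 1 := ⟨n₂ - 1, by omega⟩
  refine intPoly_eq_of_aeval fun x hx => ?_
  have h1' : (c : ℝ) + 1 = b ^ 2 := by exact_mod_cast h1
  have h3' : (d : ℝ) + 1 = a ^ 2 - (b + 1) ^ 2 := by exact_mod_cast h3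
  obtain ⟨u2, u3, u4, u5, u6⟩ := pathVal_small x
  have hx0 : x ≠ 0 := by linarith
  have hx1 : x ^ 2 - 1 ≠ 0 := by nlinarith
  rw [aeval_of_iso e hx]
  simp only [Fin.prod_univ_two, Fin.sum_univ_two]
  simp [u2, u3]
  have key : x * (x ^ 2 - 1) *
      (x - (((c : ℝ) + 1) * x⁻¹ + ((d : ℝ) + 1) * (x / (x ^ 2 - 1)))) =
      (x ^ 2 - a * x + b) * (x ^ 2 + a * x + b) := by
    field_simp
    rw [h1', h3']
    ring
  rw [pow_succ, pow_succ]
  linear_combination (x ^ c * (x ^ 2 - 1) ^ d) * key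

/-! ### Quadraticity and form (II) from the characteristic polynomial -/

lemma quadratic_integral {μ : ℝ} {c d : ℤ} (h : μ ^ 2 + c * μ + d = 0) :
    IsIntegral ℤ μ ∧ (minpoly ℤ μ).natDegree ≤ 2 := by
  have hm : (X ^ 2 + C c * X + C d : ℤ[X]).Monic := by monicity!
  have h0 : aeval μ (X ^ 2 + C c * X + C d : ℤ[X]) = 0 := by simpa using h
  refine ⟨⟨_, hm, h0⟩, ?_⟩
  calc (minpoly ℤ μ).natDegree ≤ (X ^ 2 + C c * X + C d : ℤ[X]).natDegree :=
        natDegree_le_natDegree (minpoly.min ℤ μ hm h0)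
    _ ≤ 2 := by compute_degree

/-- The point is that `ρ = (a + √(a² - 4b))/2` is the largest root. At any `μ > ρ` the product `(μ²
+ b)² - a²μ²` of the two quadratics is positive, whereas `h3`, `h4` and `h5` make it nonpositive at
a competing root `√2`, golden ratio or `√3` whenever that factor occurs. -/
theorem quadratic_and_formII {t₁ t₂ t₃ t₄ t₅ : ℕ} (hf : graphCharpoly T = X ^ t₁ * (X ^ 2 - 1) ^ t₂ *
      (X ^ 2 - 2) ^ t₃ * ((X ^ 2 - X - 1) * (X ^ 2 + X - 1)) ^ t₄ * (X ^ 2 - 3) ^ t₅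
        * ((X ^ 2 - C a * X + C b) * (X ^ 2 + C a * X + C b)))
    (ha : 0 < a) (hD : ¬ IsSquare (a ^ 2 - 4 * b)) (hpos : 0 < a ^ 2 - 4 * b)
    (h3 : t₃ = 0 ∨ (2 + b) ^ 2 < 2 * a ^ 2)
    (h4 : t₄ = 0 ∨ b ^ 2 - 1 ≤ 2 * (a ^ 2 - 2 * b - 3) ∧ 0 < a ^ 2 - 2 * b - 3)
    (h5 : t₅ = 0 ∨ (3 + b) ^ 2 < 3 * a ^ 2) : IsQuadraticGraph T ∧ HasFormII T a b := by
  have ha' : (0 : ℝ) < a := by exact_mod_cast ha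
  have hpos' : (0 : ℝ) < a ^ 2 - 4 * b := by exact_mod_cast hpos
  have hroot : ∀ μ : ℝ, aeval μ (graphCharpoly T) = 0 ↔
      (((((μ ^ t₁ = 0 ∨ (μ ^ 2 - 1) ^ t₂ = 0) ∨ (μ ^ 2 - 2) ^ t₃ = 0) ∨
        ((μ ^ 2 - μ - 1) * (μ ^ 2 + μ - 1)) ^ t₄ = 0) ∨ (μ ^ 2 - 3) ^ t₅ = 0) ∨
        (μ ^ 2 - a * μ + b = 0 ∨ μ ^ 2 + a * μ + b = 0)) := by
    intro μ
    rw [hf]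
    simp only [map_mul, map_pow, map_sub, map_add, aeval_X, map_one, map_ofNat, eq_intCast,
      map_intCast, mul_eq_zero]
  constructor
  · intro μ hμ
    rcases (hroot μ).1 hμ with ((((h | h) | h) | h) | h) | h | h
    · exact quadratic_integral (c := 0) (d := 0) (by simp [eq_zero_of_pow_eq_zero h])
    · exact quadratic_integral (c := 0) (d := -1) (by
        push_cast; linarith [eq_zero_of_pow_eq_zero h])
    · exact quadratic_integral (c := 0) (d := -2) (by
        push_cast; linarith [eq_zero_of_pow_eq_zero h])
    · rcases mul_eq_zero.1 (eq_zero_of_pow_eq_zero h) with h | h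
      · exact quadratic_integral (c := -1) (d := -1) (by push_cast; linarith)
      · exact quadratic_integral (c := 1) (d := -1) (by push_cast; linarith)
    · exact quadratic_integral (c := 0) (d := -3) (by
        push_cast; linarith [eq_zero_of_pow_eq_zero h])
    · exact quadratic_integral (c := -a) (d := b) (by push_cast; linarith)
    · exact quadratic_integral (c := a) (d := b) (by linarith)
  · refine ⟨ha, hpos, (irreducible_quadratic_iff a b).2 hD, ?_, t₁, t₂, t₃, t₄, t₅, hf⟩
    set s := √((a : ℝ) ^ 2 - 4 * b) with hs
    have hs0 : 0 < s := Real.sqrt_pos.2 hpos'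
    have hs2 : s ^ 2 = a ^ 2 - 4 * b := Real.sq_sqrt hpos'.le
    have hρ : ((a + s) / 2) ^ 2 - a * ((a + s) / 2) + b = 0 := by linear_combination hs2 / 4
    refine ⟨(a + s) / 2, ⟨(hroot _).2 (Or.inr (Or.inl hρ)), fun μ hμ => ?_⟩, hρ⟩
    by_contra hlt
    rw [not_le] at hlt
    have e1 : 0 < μ ^ 2 - a * μ + b := by
      have : μ ^ 2 - a * μ + b = (μ - (a + s) / 2) * (μ - (a - s) / 2) := by
        linear_combination hs2 / 4
      rw [this]
      exact mul_pos (by linarith) (by linarith)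
    have hμ0 : 0 < μ := by linarith
    have e2 : 0 < μ ^ 2 + a * μ + b := by
      have := mul_pos ha' hμ0
      linarith
    have e3 : 0 < (μ ^ 2 + b) ^ 2 - a ^ 2 * μ ^ 2 := by
      have := mul_pos e1 e2
      linarith
    -- A positive nonsquare discriminant is at least `2`; with `a ≥ 1` this gives `ρ > 1`, which
    -- disposes of `x² - 1`.
    have hs1 : 1 < s := by
      have hne : a ^ 2 - 4 * b ≠ 1 := fun h' => hD (by rw [h']; exact IsSquare.one)
      have : (2 : ℝ) ≤ a ^ 2 - 4 * b := by exact_mod_cast (by omega : (2 : ℤ) ≤ a ^ 2 - 4 * b)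
      exact (Real.lt_sqrt zero_le_one).2 (by linarith)
    have ha1 : (1 : ℝ) ≤ a := by exact_mod_cast ha
    have hexp : ∀ {c : ℝ} {t : ℕ}, c ^ t = 0 → t ≠ 0 ∧ c = 0 := fun h =>
      ⟨fun h' => by simp [h'] at h, eq_zero_of_pow_eq_zero h⟩
    rcases (hroot μ).1 hμ with ((((h | h) | h) | h) | h) | h | h
    · exact hμ0.ne' (hexp h).2
    · nlinarith [(hexp h).2]
    · obtain ⟨ht, h⟩ := hexp h
      have h3' : (2 + (b : ℝ)) ^ 2 < 2 * a ^ 2 := by exact_mod_cast h3.resolve_left ht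
      rw [show μ ^ 2 = 2 by linarith] at e3
      linarith
    · obtain ⟨ht, h⟩ := hexp h
      obtain ⟨h4', h4''⟩ := h4.resolve_left ht
      have k1 : (b : ℝ) ^ 2 - 1 ≤ 2 * (a ^ 2 - 2 * b - 3) := by exact_mod_cast h4'
      have k2 : (0 : ℝ) < a ^ 2 - 2 * b - 3 := by exact_mod_cast h4''
      have hy : (μ ^ 2) ^ 2 = 3 * μ ^ 2 - 1 := by linear_combination h
      have e4 : 0 < b ^ 2 - 1 - (a ^ 2 - 2 * b - 3) * μ ^ 2 := by linear_combination e3 + hy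
      -- The roots of `y² - 3y + 1` avoid `[1, 2]`, because `(y - 1)(2 - y) = -1` there; so `μ² > 1`
      -- improves to `μ² > 2`.
      have hμ1 : 1 < μ ^ 2 := one_lt_pow₀ (by linarith) two_ne_zero
      have e5 : 2 < μ ^ 2 := by
        by_contra h6
        have := mul_nonneg (sub_pos.2 hμ1).le (sub_nonneg.2 (not_lt.1 h6))
        linarith
      have := mul_pos k2 (sub_pos.2 e5)
      linarith
    · obtain ⟨ht, h⟩ := hexp h
      have h5' : (3 + (b : ℝ)) ^ 2 < 3 * a ^ 2 := by exact_mod_cast h5.resolve_left ht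
      rw [show μ ^ 2 = 3 by linarith] at e3
      linarith
    · linarith
    · linarith

end Families

/-! ### The classification -/

lemma branchCount_twelve {m : Fin 12 → ℕ} {v : ℕ → ℕ} (hv : ∀ i, 5 ≤ i → v i = 0)
    (hm : ∀ i, 5 ≤ i.val → m i = 0) (h0 : m 0 = v 0) (h1 : m 1 = v 1) (h2 : m 2 = v 2)
    (h3 : m 3 = v 3) (h4 : m 4 = v 4) (i : ℕ) : branchCount m i = v i := by
  rcases lt_or_ge i 5 with hi | hi
  · interval_cases i <;> assumption
  · rw [hv i hi, branchCount]
    split_ifs with h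
    · exact hm _ hi
    · rfl

section Main

variable {V : Type*} [Fintype V] [DecidableEq V] {T : SimpleGraph V} [DecidableRel T.Adj]
  {a b : ℤ}

/-- After `branch_bound`, the tree is re-encoded by a multiplicity vector on `Fin 12`; the lengths
are then eliminated from the longest downwards, each step using the earlier ones. -/
theorem exists_admissibleBranches (hT : IsStarlikeTree T) (hclaw : ProperlyContainsClaw T)
    (h : HasFormII T a b) : ∃ m : Fin 12 → ℕ, Nonempty (T ≃g starlikeTree m) ∧
      (∀ i, 5 ≤ i.val → m i = 0) ∧ AdmissibleBranches m a b := by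
  classical
  obtain ⟨k, n, ⟨e⟩⟩ := hT
  have hform := h
  obtain ⟨ha, -, hirr, ⟨ρ, hρ, hroot⟩, -⟩ := h
  have hD := (irreducible_quadratic_iff a b).1 hirr
  obtain ⟨τ, hτ⟩ := exists_eigenvaluesBelow hform hroot
  have hgreat : ∀ {k : ℕ} {n : Fin k → ℕ} (_ : T ≃g starlikeTree n),
      IsGreatest (graphEigenvalues (starlikeTree n)) ρ := fun e => by
    unfold graphEigenvalues at hρ ⊢
    rwa [← graphCharpoly_iso e]
  have hbelow : ∀ {k : ℕ} {n : Fin k → ℕ} (_ : T ≃g starlikeTree n),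
      EigenvaluesBelow (graphCharpoly (starlikeTree n)) ρ τ := fun e => by
    rwa [← graphCharpoly_iso e]
  have hgaps := hasGaps (hgreat e) (hbelow e)
  set m : Fin 12 → ℕ := fun i => branchCount n i.val with hm
  have hcount : ∀ i, branchCount n i = branchCount m i := by
    intro i
    by_cases hi : i < 12
    · rw [show i = (⟨i, hi⟩ : Fin 12).val from rfl, branchCount_val m ⟨i, hi⟩]
    · have h0 : branchCount m i = 0 := by simp [branchCount, hi]
      rw [h0]
      by_contra hne
      have hpos := Nat.pos_of_ne_zero hne
      have hik := lt_of_branchCount_pos hpos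
      rw [show i = (⟨i, hik⟩ : Fin k).val from rfl, branchCount_val] at hpos
      have := hgaps.branch_bound hpos
      simp only at this
      omega
  obtain ⟨e'⟩ := nonempty_starlikeTree_iso n m hcount
  have em := e.trans e'
  have hgm := hgreat em
  have hbm := hbelow em
  have hG := hasGaps hgm hbm
  have hsum := three_le_of_claw hclaw em
  obtain ⟨hpos, heq⟩ := greatest_eq_sum hgm
  have h10 : m 10 = 0 := by
    by_contra hne
    have := hG.branch_bound (Nat.pos_of_ne_zero hne)
    norm_num at this
  have hu : ∀ i : Fin 12, 5 ≤ i.val → m i ≤ 1 := fun i hi => branch_unique hgm hbm hi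
  have hsix : 0 < m 4 → 3 < ρ ^ 2 := fun h4 => by
    have h5 := branch_lt_greatest hgm h4
    have h6 : 2 * Real.cos (Real.pi / ((4 : Fin 12).val + 2 : ℕ)) = √3 := by
      rw [show (4 : Fin 12).val + 2 = 6 from rfl, Nat.cast_ofNat, Real.cos_pi_div_six]
      ring
    rw [h6] at h5
    have h7 := Real.sq_sqrt (show (0 : ℝ) ≤ 3 by norm_num)
    have h8 := Real.sqrt_nonneg (3 : ℝ)
    nlinarith
  have hp1 := hpos 1
  have hp3 := hpos 3
  have hp4 := hpos 4
  rw [sum_fin_twelve m (fun i => pathVal ρ (i + 1) / pathVal ρ (i + 2))] at heq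
  simp only [Fin.sum_univ_succ, Fin.sum_univ_zero] at hsum
  have hs : 3 ≤ m 0 + m 1 + m 2 + m 3 + m 4 + m 5 + m 6 + m 7 + m 8 + m 9 + m 10 + m 11 := by
    convert hsum using 1
    simp only [← add_assoc]
    rfl
  clear_value m
  have h11 := hG.eq_zero_eleven h10 (hu 11 (by decide))
  have h9 := hG.eq_zero_nine (by omega) h11 h10 (hu 5 (by decide)) (hu 9 (by decide))
  have h8 := hG.eq_zero_eight (by omega) h9 (hu 8 (by decide))
  have h7 := hG.eq_zero_seven (by omega) h11 h10 h9 h8 (hu 7 (by decide))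
  have h6 := hG.eq_zero_six (by omega) h11 h10 h9 h8 h7 (hu 6 (by decide))
  have h5 := hG.eq_zero_five (by omega) h11 h10 h9 h8 h7 h6 (hu 5 (by decide))
  have hshort := hG.shortBranches (by omega) h11 h10 h9 h8 h7 h6 h5
  refine ⟨m, ⟨em⟩, ?_, admissible_of_short hshort (by omega) ha hD hroot hp1 hp3
    (fun h => ⟨hp4 h, hsix h⟩) ?_⟩
  · intro i hi
    fin_cases i <;> first | assumption | (simp at hi)
  · simpa [h5, h6, h7, h8, h9, h10, h11] using heq

theorem form_of_iso (ha : 0 < a) (hD : ¬ IsSquare (a ^ 2 - 4 * b))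
    (h : (∃ n₅ : ℕ, Cond₁ a b n₅ ∧ Nonempty (T ≃g starlikeTree ![0, 0, 1, 0, n₅])) ∨
         (∃ n₄ : ℕ, Cond₂ a b n₄ ∧ Nonempty (T ≃g starlikeTree ![0, 0, 0, n₄])) ∨
         (∃ n₄ : ℕ, Cond₃ a b n₄ ∧ Nonempty (T ≃g starlikeTree ![2, 0, 0, n₄])) ∨
         (∃ n₁ n₃ : ℕ, Cond₄ a b n₁ n₃ ∧ Nonempty (T ≃g starlikeTree ![n₁, 0, n₃])) ∨
         (∃ n₁ n₂ : ℕ, Cond₅ a b n₁ n₂ ∧ Nonempty (T ≃g starlikeTree ![n₁, n₂]))) :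
    IsQuadraticGraph T ∧ HasFormII T a b := by
  rcases h with ⟨n₅, h, ⟨e⟩⟩ | ⟨n₄, h, ⟨e⟩⟩ | ⟨n₄, h, ⟨e⟩⟩ | ⟨n₁, n₃, h, ⟨e⟩⟩ | ⟨n₁, n₂, h, ⟨e⟩⟩
  · have hf := charpoly_family₁ h e
    obtain ⟨h1, h2, h3⟩ := h
    refine quadratic_and_formII (t₁ := n₅) (t₂ := n₅ - 1) (t₃ := 0) (t₄ := 1) (t₅ := n₅ - 1)
      (by rw [hf]; ring) ha hD ?_ (Or.inl rfl) (Or.inr ⟨?_, ?_⟩) (Or.inr ?_)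
    -- The condition on `a` gives `2(a² - 4b) = (b - 2)² + 1`.
    · nlinarith [sq_nonneg (b - 2)]
    · linarith
    · linarith
    · linarith
  · have hf := charpoly_family₂ h e
    obtain ⟨h1, h2, h3⟩ := h
    refine quadratic_and_formII (t₁ := 1) (t₂ := 0) (t₃ := 0) (t₄ := n₄ - 1) (t₅ := 0)
      (by rw [hf]; ring) ha hD ?_ (Or.inl rfl) (Or.inr ⟨?_, ?_⟩) (Or.inl rfl)
    · nlinarith [sq_nonneg (b - 2)]
    · linarith
    · linarith
  · have hf := charpoly_family₃ h e
    obtain ⟨h2, h1⟩ := h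
    refine quadratic_and_formII (t₁ := 1) (t₂ := 0) (t₃ := 1) (t₄ := n₄ - 1) (t₅ := 0)
      (by rw [hf]; ring) ha hD ?_ (Or.inr ?_) (Or.inr ⟨?_, ?_⟩) (Or.inl rfl) <;>
    rcases h1 with ⟨h1, rfl⟩ | ⟨h1, rfl⟩ <;> linarith
  · have hf := charpoly_family₄ h e
    obtain ⟨h1, h3, h4, -⟩ := h
    refine quadratic_and_formII (t₁ := n₁ + n₃ - 1) (t₂ := 0) (t₃ := n₃ - 1) (t₄ := 0) (t₅ := 0)
      (by rw [hf]; ring) ha hD ?_ (Or.inr ?_) (Or.inl rfl) (Or.inl rfl)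
    · nlinarith [sq_nonneg (b - 2)]
    · linarith
  · have hf := charpoly_family₅ h e
    obtain ⟨h1, h2, h3, h4, -⟩ := h
    refine quadratic_and_formII (t₁ := n₁ - 1) (t₂ := n₂ - 1) (t₃ := 0) (t₄ := 0) (t₅ := 0)
      (by rw [hf]; ring) ha hD ?_ (Or.inl rfl) (Or.inl rfl) (Or.inl rfl)
    nlinarith [sq_nonneg (b - 1)]

theorem iso_of_form (hT : IsStarlikeTree T) (hclaw : ProperlyContainsClaw T)
    (h : HasFormII T a b) :
    (∃ n₅ : ℕ, Cond₁ a b n₅ ∧ Nonempty (T ≃g starlikeTree ![0, 0, 1, 0, n₅])) ∨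
    (∃ n₄ : ℕ, Cond₂ a b n₄ ∧ Nonempty (T ≃g starlikeTree ![0, 0, 0, n₄])) ∨
    (∃ n₄ : ℕ, Cond₃ a b n₄ ∧ Nonempty (T ≃g starlikeTree ![2, 0, 0, n₄])) ∨
    (∃ n₁ n₃ : ℕ, Cond₄ a b n₁ n₃ ∧ Nonempty (T ≃g starlikeTree ![n₁, 0, n₃])) ∨
    (∃ n₁ n₂ : ℕ, Cond₅ a b n₁ n₂ ∧ Nonempty (T ≃g starlikeTree ![n₁, n₂])) := by
  obtain ⟨m, ⟨e⟩, hm, hadm⟩ := exists_admissibleBranches hT hclaw h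
  have key : ∀ {k : ℕ} (n : Fin k → ℕ), k ≤ 5 → m 0 = branchCount n 0 → m 1 = branchCount n 1 →
      m 2 = branchCount n 2 → m 3 = branchCount n 3 → m 4 = branchCount n 4 →
      Nonempty (T ≃g starlikeTree n) := fun n hk h0 h1 h2 h3 h4 =>
    (nonempty_starlikeTree_iso m n (branchCount_twelve
      (fun i hi => by rw [branchCount, dif_neg (by omega)]) hm h0 h1 h2 h3 h4)).map e.trans
  rcases hadm with ⟨h0, h1, h2, h3, hc⟩ | ⟨h0, h1, h2, h4, hc⟩ | ⟨h0, h1, h2, h4, hc⟩ |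
    ⟨h1, h3, h4, hc⟩ | ⟨h2, h3, h4, hc⟩
  · exact Or.inl ⟨m 4, hc, key _ le_rfl h0 h1 h2 h3 rfl⟩
  · exact Or.inr (Or.inl ⟨m 3, hc, key _ (by norm_num) h0 h1 h2 rfl h4⟩)
  · exact Or.inr (Or.inr (Or.inl ⟨m 3, hc, key _ (by norm_num) h0 h1 h2 rfl h4⟩))
  · exact Or.inr (Or.inr (Or.inr (Or.inl ⟨m 0, m 2, hc, key _ (by norm_num) rfl h1 rfl h3 h4⟩)))
  · exact Or.inr (Or.inr (Or.inr (Or.inr ⟨m 0, m 1, hc, key _ (by norm_num) rfl rfl h2 h3 h4⟩)))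

end Main

theorem mainTheorem1 {V : Type*} [Fintype V] [DecidableEq V]
    (T : SimpleGraph V) [DecidableRel T.Adj]
    (hT : IsStarlikeTree T) (hclaw : ProperlyContainsClaw T) (a b : ℤ) :
    ((IsQuadraticGraph T ∧ HasFormII T a b) ↔
      (0 < a ∧ ¬ IsSquare (a ^ 2 - 4 * b) ∧
        ((∃ n₅ : ℕ, Cond₁ a b n₅ ∧ Nonempty (T ≃g starlikeTree ![0, 0, 1, 0, n₅])) ∨
         (∃ n₄ : ℕ, Cond₂ a b n₄ ∧ Nonempty (T ≃g starlikeTree ![0, 0, 0, n₄])) ∨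
         (∃ n₄ : ℕ, Cond₃ a b n₄ ∧ Nonempty (T ≃g starlikeTree ![2, 0, 0, n₄])) ∨
         (∃ n₁ n₃ : ℕ, Cond₄ a b n₁ n₃ ∧ Nonempty (T ≃g starlikeTree ![n₁, 0, n₃])) ∨
         (∃ n₁ n₂ : ℕ, Cond₅ a b n₁ n₂ ∧ Nonempty (T ≃g starlikeTree ![n₁, n₂]))))) ∧
    (∀ n₅ : ℕ, Cond₁ a b n₅ → Nonempty (T ≃g starlikeTree ![0, 0, 1, 0, n₅]) →
      graphCharpoly T =
        X ^ n₅ * (X ^ 2 - 1) ^ (n₅ - 1) * (X ^ 2 - X - 1) * (X ^ 2 + X - 1)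
          * (X ^ 2 - 3) ^ (n₅ - 1)
          * (X ^ 2 - C a * X + C b) * (X ^ 2 + C a * X + C b)) ∧
    (∀ n₄ : ℕ, Cond₂ a b n₄ → Nonempty (T ≃g starlikeTree ![0, 0, 0, n₄]) →
      graphCharpoly T =
        X * ((X ^ 2 - X - 1) * (X ^ 2 + X - 1)) ^ (n₄ - 1)
          * (X ^ 2 - C a * X + C b) * (X ^ 2 + C a * X + C b)) ∧
    (∀ n₄ : ℕ, Cond₃ a b n₄ → Nonempty (T ≃g starlikeTree ![2, 0, 0, n₄]) →
      graphCharpoly T =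
        X * (X ^ 2 - 2) * ((X ^ 2 - X - 1) * (X ^ 2 + X - 1)) ^ (n₄ - 1)
          * (X ^ 2 - C a * X + C b) * (X ^ 2 + C a * X + C b)) ∧
    (∀ n₁ n₃ : ℕ, Cond₄ a b n₁ n₃ → Nonempty (T ≃g starlikeTree ![n₁, 0, n₃]) →
      graphCharpoly T =
        X ^ (n₁ + n₃ - 1) * (X ^ 2 - 2) ^ (n₃ - 1)
          * (X ^ 2 - C a * X + C b) * (X ^ 2 + C a * X + C b)) ∧
    (∀ n₁ n₂ : ℕ, Cond₅ a b n₁ n₂ → Nonempty (T ≃g starlikeTree ![n₁, n₂]) →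
      graphCharpoly T =
        X ^ (n₁ - 1) * (X ^ 2 - 1) ^ (n₂ - 1)
          * (X ^ 2 - C a * X + C b) * (X ^ 2 + C a * X + C b)) := by
  refine ⟨⟨fun ⟨_, h⟩ => ⟨h.1, (irreducible_quadratic_iff a b).1 h.2.2.1, iso_of_form hT hclaw h⟩,
    fun ⟨ha, hD, h⟩ => form_of_iso ha hD h⟩, fun _ h ⟨e⟩ => charpoly_family₁ h e,
    fun _ h ⟨e⟩ => charpoly_family₂ h e, fun _ h ⟨e⟩ => charpoly_family₃ h e,
    fun _ _ h ⟨e⟩ => charpoly_family₄ h e, fun _ _ h ⟨e⟩ => charpoly_family₅ h e⟩
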